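/- Let $q$ be a power of $2$. Let $\rho_1,\rho_2,\rho_3$ be involutions (elements of order $2$) of $\mathrm{PSL}(3,q)$ such that $G=\langle\rho_1,\rho_2,\rho_3\rangle$ with the triple $(\rho_1,\rho_2,\rho_3)$ is a string $C$-group of rank $3$, i.e. $\rho_1$ and $\rho_3$ commute and $\langle \rho_i\mid i\in I\rangle\cap\langle\rho_j\mid j\in J\rangle=\langle\rho_i\mid i\in I\cap J\rangle$ for all $I,J\subseteq\{1,2,3\}$. Suppose that $G$ does not stabilise a point and a line of $\mathrm{PG}(2,q)$ that are incident with each other. Call $r$ a root of $q$ if $r^d=q$ for some integer $d\ge 1$. Then, up to isomorphism, $G$ is one of the following: - $E_{q'}^2:D_{2k}$ for some $k\ge 3$, where $q'$ is the smallest root of $q$ such that $k$ divides $q'-1$ or $q'+1$. This denotes a semidirect product of the additive group $\mathbb{F}_{q'}^2$ by the dihedral group $D_{2k}$ of order $2k$, acting faithfully and $\mathbb{F}_{q'}$-linearly on $\mathbb{F}_{q'}^2$; - $\mathrm{PSO}(3,q')$, which is isomorphic to $\mathrm{PSL}(2,q')$, for some root $q'$ of $q$ (in particular $q'\mid q$).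 Here $\mathrm{PSO}(3,q')$ is the image in $\mathrm{PSL}(3,q')$ of the group of determinant-one matrices over $\mathbb{F}_{q'}$ preserving the quadratic form $x_0x_2+x_1^2$. -/

import Mathlib

/-- A tuple `ρ` of elements of a group `Γ` makes the subgroup it generates a string C-group
(of rank `r`): its entries are involutions, entries with non-neighbouring indices commute
(string property), and the parabolic subgroups satisfy the intersection property. -/
structure IsStringCGroup {Γ : Type*} [Group Γ] {r : ℕ} (ρ : Fin r → Γ) : Prop where
  involution : ∀ i, orderOf (ρ i) = 2
  string : ∀ i j : Fin r, (i : ℕ) + 1 < (j : ℕ) → Commute (ρ i) (ρ j)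
  intersection : ∀ I J : Set (Fin r),
    Subgroup.closure (ρ '' I) ⊓ Subgroup.closure (ρ '' J) = Subgroup.closure (ρ '' (I ∩ J))

/-- The subgroup `G` of `PSL(n,K)` stabilises the subspace `W` of `Kⁿ`: every matrix of
determinant one whose class lies in `G` maps `W` onto itself. -/
def StabilisesSubspace {K : Type*} [Field K] {n : ℕ}
    (G : Subgroup (Matrix.ProjectiveSpecialLinearGroup (Fin n) K))
    (W : Submodule K (Fin n → K)) : Prop :=
  ∀ A : Matrix.SpecialLinearGroup (Fin n) K,
    (QuotientGroup.mk A : Matrix.ProjectiveSpecialLinearGroup (Fin n) K) ∈ G →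
      W.map (Matrix.toLin' (A : Matrix (Fin n) (Fin n) K)) = W

/-- `G ≤ PSL(3,K)` stabilises a point `P` and a line `L` of `PG(2,K)` that are incident.
Points and lines are the subspaces of `K³` of dimension one and two. -/
def StabilisesIncidentPointLine {K : Type*} [Field K]
    (G : Subgroup (Matrix.ProjectiveSpecialLinearGroup (Fin 3) K)) : Prop :=
  ∃ P L : Submodule K (Fin 3 → K),
    Module.finrank K P = 1 ∧ Module.finrank K L = 2 ∧ P ≤ L ∧
      StabilisesSubspace G P ∧ StabilisesSubspace G L

/-- `q'` is a root of `q`: some positive power of `q'` is `q`. -/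
def IsRootOfNat (q' q : ℕ) : Prop := ∃ d : ℕ, 0 < d ∧ q' ^ d = q

/-- `q'` is the smallest root of `q` such that `k` divides `q' - 1` or `q' + 1`.
(Roots of a positive `q` are positive, so the subtraction is the true one.) -/
def IsSmallestRootFor (k q' q : ℕ) : Prop :=
  IsLeast {r : ℕ | IsRootOfNat r q ∧ (k ∣ r - 1 ∨ k ∣ r + 1)} q'

/-- `G` is a group `E_{q'}² : D_{2k}`, where `F` is the field with `q'` elements: a semidirect
product of the additive group `F²` by the dihedral group of order `2k`,
which acts on `F²` faithfully by `F`-linear maps. -/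
def IsFieldSquareByDihedral (F : Type*) [Field F] (k : ℕ) (G : Type*) [Group G] : Prop :=
  ∃ φ : DihedralGroup k →* MulAut (Multiplicative (Fin 2 → F)),
    Function.Injective φ ∧
    (∀ (g : DihedralGroup k) (c : F) (v : Fin 2 → F),
      (φ g (Multiplicative.ofAdd (c • v))).toAdd
        = c • (φ g (Multiplicative.ofAdd v)).toAdd) ∧
    Nonempty (G ≃* SemidirectProduct (Multiplicative (Fin 2 → F)) (DihedralGroup k) φ)

/-- The standard non-degenerate quadratic form `x₀ x₂ + x₁²` in three variables. -/
def ternaryForm {F : Type*} [Field F] (v : Fin 3 → F) : F := v 0 * v 2 + v 1 ^ 2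

/-- `SO(3,F)`: the matrices of determinant one that preserve the standard ternary form. -/
def SO3 (F : Type*) [Field F] : Subgroup (Matrix.SpecialLinearGroup (Fin 3) F) where
  carrier := {A | ∀ v : Fin 3 → F,
    ternaryForm ((A : Matrix (Fin 3) (Fin 3) F).mulVec v) = ternaryForm v}
  one_mem' := by
    intro v
    simp
  mul_mem' := by
    intro A B hA hB v
    rw [Matrix.SpecialLinearGroup.coe_mul, ← Matrix.mulVec_mulVec, hA, hB]
  inv_mem' := by
    intro A hA v
    rw [← hA, Matrix.mulVec_mulVec, ← Matrix.SpecialLinearGroup.coe_mul, mul_inv_cancel]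
    simp

/-- `PSO(3,F)`: the image of `SO(3,F)` in `PSL(3,F)`. -/
def PSO3 (F : Type*) [Field F] :
    Subgroup (Matrix.ProjectiveSpecialLinearGroup (Fin 3) F) :=
  (SO3 F).map (QuotientGroup.mk' (Subgroup.center (Matrix.SpecialLinearGroup (Fin 3) F)))

/-! In characteristic two an involution of `PSL(3,K)` lifts to an involution of `SL(3,K)`, because
the centre has exponent three. Such a lift is an elation `1 + v fᵀ` with `f ⬝ᵥ v = 0`: its centre is
`v` and its axis is the kernel of `f`. If two elations commute, each centre lies on the other axis,
so `T 0` and `T 2` share an axis or a centre. The inverse transpose exchanges the two cases, so a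
common axis `f` may be assumed. If the third elation, with axis `g`, is in special position, an
incident point and line are fixed; this is what the flag hypothesis excludes.

In general position all three elations fix the vector `w = f × g`, and modulo `w` they become
`upperUnip 1`, `upperUnip c`, `lowerUnip d` in `SL(2,K)`, after scaling.

If `c` is neither `0` nor `1`, a change of basis carries the group into a copy of `SL(2,K)` embedded
by `orthogonalHom s`, so it is isomorphic to the group generated by the three transvections. That
group is `SL(2,F)` for a subfield `F` (`exists_subfield_closure_eq_range`), by a count of
involutions on the projective line (`exists_conj_eq_of_smul_eq`). In characteristic two `SL(2,F)` is
both `PSO(3,F)` and `PSL(2,F)`.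

If `c = 0`, one elation has centre `w`. The other two generate a dihedral group, and the translates
of the third span `F²` with `F` generated by `d` (`isListedGroup_closure_elation`). The eigenvalues
of `upperUnip 1 * lowerUnip d` are the roots of `X² + dX + 1`; comparing Frobenius powers of them
shows that `F` is as small as the dihedral order allows (`isSmallestRootFor_orderOf`). If `c = 1`,
replacing `T₃` by `T₁ * T₃` gives the case `c = 0`. -/

section

open Matrix

/-! ### Counting involutions in a finite permutation group -/

/-- Let a finite group act so that every involution has exactly one fixed point and no nontrivial
element of a two-point stabiliser centralises an involution fixing the second point. Then the
stabiliser of two points fixed by involutions permutes transitively, by conjugation, the involutions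
fixing the second point. -/
theorem exists_conj_eq_of_smul_eq {H X : Type*} [Group H] [Finite H] [MulAction H X] [Finite X]
    (hfix : ∀ t : H, t * t = 1 → t ≠ 1 → ∃ x : X, t • x = x ∧ ∀ y : X, t • y = y → y = x)
    (hfree : ∀ (h u : H) (a b : X), a ≠ b → h • a = a → h • b = b → u * u = 1 → u ≠ 1 →
      u • b = b → h * u = u * h → h = 1)
    {a b : X} (hab : a ≠ b) (ha : ∃ u : H, u * u = 1 ∧ u ≠ 1 ∧ u • a = a)
    {u v : H} (hu : u * u = 1) (hu1 : u ≠ 1) (hub : u • b = b)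
    (hv : v * v = 1) (hv1 : v ≠ 1) (hvb : v • b = b) :
    ∃ h : H, h • a = a ∧ h • b = b ∧ h * u * h⁻¹ = v := by
  classical
  have := Fintype.ofFinite H
  have := Fintype.ofFinite X
  -- The involutions moving `a` are counted twice: by the image `x` of `a` (the sets `I x`) and by
  -- their fixed point `x` (the sets `U x`). The two-point stabiliser `S x` separates the counts:
  -- `|I x| ≤ |S x| ≤ |U x|` whenever `I x` is nonempty.
  let U : X → Finset H := fun x ↦ Finset.univ.filter fun u ↦ u * u = 1 ∧ u ≠ 1 ∧ u • x = x
  let S : X → Finset H := fun x ↦ Finset.univ.filter fun h ↦ h • a = a ∧ h • x = x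
  let I : X → Finset H := fun x ↦ Finset.univ.filter fun u ↦ u * u = 1 ∧ u • a = x
  have hIS : ∀ x, x ≠ a → (I x).card ≤ (S x).card := by
    intro x hx
    rcases (I x).eq_empty_or_nonempty with h0 | ⟨t, ht⟩
    · simp [h0]
    simp only [I, Finset.mem_filter, Finset.mem_univ, true_and] at ht
    have htx : t • x = a := by rw [← ht.2, ← mul_smul, ht.1, one_smul]
    refine Finset.card_le_card_of_injOn (fun u ↦ t * u) ?_ (fun u _ v _ h ↦ mul_left_cancel h)
    intro u hu
    simp only [I, S, Finset.coe_filter, Finset.mem_univ, true_and, Set.mem_ofPred_eq] at hu ⊢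
    have hux : u • x = a := by rw [← hu.2, ← mul_smul, hu.1, one_smul]
    exact ⟨by rw [mul_smul, hu.2, htx], by rw [mul_smul, hux, ht.2]⟩
  have hmaps : ∀ x (u : H), u * u = 1 → u ≠ 1 → u • x = x →
      Set.MapsTo (fun h ↦ h * u * h⁻¹) (S x) (U x) := by
    intro x u hu1 hu2 hu3 h hh
    simp only [U, S, Finset.coe_filter, Finset.mem_univ, true_and, Set.mem_ofPred_eq] at hh ⊢
    refine ⟨?_, fun h1 ↦ hu2 (conj_eq_one_iff.mp h1), ?_⟩
    · calc h * u * h⁻¹ * (h * u * h⁻¹) = h * (u * u) * h⁻¹ := by group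
        _ = 1 := by rw [hu1]; group
    · rw [mul_smul, mul_smul, inv_smul_eq_iff.mpr hh.2.symm, hu3, hh.2]
  have hinj : ∀ x (u : H), x ≠ a → u * u = 1 → u ≠ 1 → u • x = x →
      Set.InjOn (fun h ↦ h * u * h⁻¹) (S x) := by
    intro x u hx hu1 hu2 hu3 h hh k hk hhk
    simp only [S, Finset.coe_filter, Finset.mem_univ, true_and, Set.mem_ofPred_eq] at hh hk hhk
    have := hfree (k⁻¹ * h) u a x hx.symm (by rw [mul_smul, hh.1, inv_smul_eq_iff, hk.1])
      (by rw [mul_smul, hh.2, inv_smul_eq_iff, hk.2]) hu1 hu2 hu3 (by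
        calc k⁻¹ * h * u = k⁻¹ * (h * u * h⁻¹) * h := by group
          _ = u * (k⁻¹ * h) := by rw [hhk]; group)
    exact (inv_mul_eq_one.mp this).symm
  have hSU : ∀ x, x ≠ a → (U x).Nonempty → (S x).card ≤ (U x).card := by
    rintro x hx ⟨u, hu⟩
    simp only [U, Finset.mem_filter, Finset.mem_univ, true_and] at hu
    obtain ⟨hu1, hu2, hu3⟩ := hu
    exact Finset.card_le_card_of_injOn _ (hmaps x u hu1 hu2 hu3) (hinj x u hx hu1 hu2 hu3)
  -- An element `t` of `I x` swaps `a` and `x`, so it carries an involution fixing `a` to one fixing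
  -- `x`; hence `U x` is nonempty.
  have hIU : ∀ x, x ≠ a → (I x).card ≤ (U x).card := by
    intro x hx
    rcases (I x).eq_empty_or_nonempty with h0 | ⟨t, ht⟩
    · simp [h0]
    refine (hIS x hx).trans (hSU x hx ?_)
    simp only [I, Finset.mem_filter, Finset.mem_univ, true_and] at ht
    obtain ⟨u, hu1, hu2, hu3⟩ := ha
    refine ⟨t * u * t⁻¹, ?_⟩
    simp only [U, Finset.mem_filter, Finset.mem_univ, true_and]
    refine ⟨?_, fun h1 ↦ hu2 (conj_eq_one_iff.mp h1), ?_⟩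
    · calc t * u * t⁻¹ * (t * u * t⁻¹) = t * (u * u) * t⁻¹ := by group
        _ = 1 := by rw [hu1]; group
    · rw [mul_smul, mul_smul, inv_smul_eq_iff.mpr ht.2.symm, hu3, ht.2]
  let N : Finset H := Finset.univ.filter fun t ↦ t * t = 1 ∧ t • a ≠ a
  have hN : ∀ t ∈ N, t * t = 1 ∧ t ≠ 1 ∧ t • a ≠ a := by
    intro t ht
    simp only [N, Finset.mem_filter, Finset.mem_univ, true_and] at ht
    refine ⟨ht.1, ?_, ht.2⟩
    rintro rfl
    exact ht.2 (one_smul _ _)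
  have sumI : N.card = ∑ x ∈ Finset.univ.erase a, (I x).card := by
    rw [Finset.card_eq_sum_card_fiberwise (f := fun t ↦ t • a) (t := Finset.univ.erase a)]
    · refine Finset.sum_congr rfl fun x hx ↦ congrArg _ ?_
      ext t
      have := Finset.ne_of_mem_erase hx
      simp only [N, I, Finset.mem_filter, Finset.mem_univ, true_and]
      constructor
      · rintro ⟨⟨h1, h2⟩, h3⟩
        exact ⟨h1, h3⟩
      · rintro ⟨h1, h3⟩
        exact ⟨⟨h1, h3 ▸ this⟩, h3⟩
    · intro t ht
      simpa using (hN t ht).2.2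
  have : Nonempty X := ⟨a⟩
  choose! p hp hp' using hfix
  have sumU : N.card = ∑ x ∈ Finset.univ.erase a, (U x).card := by
    rw [Finset.card_eq_sum_card_fiberwise (f := p) (t := Finset.univ.erase a)]
    · refine Finset.sum_congr rfl fun x hx ↦ congrArg _ ?_
      ext t
      have hxa := Finset.ne_of_mem_erase hx
      simp only [U, Finset.mem_filter, Finset.mem_univ, true_and]
      constructor
      · rintro ⟨h1, h3⟩
        obtain ⟨h1, h2, -⟩ := hN t h1
        exact ⟨h1, h2, h3 ▸ hp t h1 h2⟩
      · rintro ⟨h1, h2, h3⟩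
        have := hp' t h1 h2 x h3
        refine ⟨?_, this.symm⟩
        simp only [N, Finset.mem_filter, Finset.mem_univ, true_and]
        exact ⟨h1, fun h ↦ hxa (this.trans (hp' t h1 h2 a h).symm)⟩
    · intro t ht
      obtain ⟨h1, h2, h3⟩ := hN t ht
      simp only [Finset.coe_erase, Finset.coe_univ, Set.mem_sdiff, Set.mem_univ,
        Set.mem_singleton_iff, true_and]
      intro h
      exact h3 (h ▸ hp t h1 h2)
  -- Equal sums with termwise inequalities are termwise equal. So `|U b| = |I b| ≤ |S b|`, and the
  -- injective conjugation map from `S b` to `U b` is onto.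
  have heq := (Finset.sum_eq_sum_iff_of_le (s := Finset.univ.erase a)
    (fun x hx ↦ hIU x (Finset.ne_of_mem_erase hx))).mp (sumI.symm.trans sumU) b
    (Finset.mem_erase.mpr ⟨hab.symm, Finset.mem_univ b⟩)
  obtain ⟨h, hh, hhv⟩ := Finset.surjOn_of_injOn_of_card_le _ (hmaps b u hu hu1 hub)
    (hinj b u hab.symm hu hu1 hub) (heq ▸ hIS b hab.symm)
    (show v ∈ (U b : Set H) by simpa [U] using ⟨hv, hv1, hvb⟩)
  simp only [S, Finset.coe_filter, Finset.mem_univ, true_and, Set.mem_ofPred_eq] at hh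
  exact ⟨h, hh.1, hh.2, hhv⟩

/-- The form of `exists_conj_eq_of_smul_eq` for a finite subgroup acting through a homomorphism. -/
theorem exists_conj_eq_of_hom_smul_eq {Γ Δ X : Type*} [Group Γ] [Group Δ] [MulAction Δ X] [Finite X]
    (φ : Γ →* Δ) (H : Subgroup Γ) [Finite H]
    (hfix : ∀ t : Γ, t * t = 1 → t ≠ 1 → ∃ x : X, φ t • x = x ∧ ∀ y : X, φ t • y = y → y = x)
    (hfree : ∀ (h u : Γ) (a b : X), a ≠ b → φ h • a = a → φ h • b = b → u * u = 1 → u ≠ 1 →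
      h * u = u * h → h = 1)
    {a b : X} (hab : a ≠ b) {w u v : Γ} (hwH : w ∈ H) (huH : u ∈ H) (hvH : v ∈ H)
    (hw : w * w = 1) (hw1 : w ≠ 1) (hwa : φ w • a = a)
    (hu : u * u = 1) (hu1 : u ≠ 1) (hub : φ u • b = b)
    (hv : v * v = 1) (hv1 : v ≠ 1) (hvb : φ v • b = b) :
    ∃ h ∈ H, φ h • a = a ∧ φ h • b = b ∧ h * u * h⁻¹ = v := by
  let _ : MulAction H X := MulAction.compHom X (φ.comp H.subtype)
  obtain ⟨h, hha, hhb, hhc⟩ := exists_conj_eq_of_smul_eq (H := H) (X := X)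
    (fun t ht ht1 ↦ hfix t (congrArg Subtype.val ht) (fun h ↦ ht1 (Subtype.ext h)))
    (fun h t x y hxy hx hy ht ht1 _ hc ↦ Subtype.ext
      (hfree h.1 t.1 x y hxy hx hy (congrArg Subtype.val ht)
        (fun h ↦ ht1 (Subtype.ext h)) (congrArg Subtype.val hc)))
    hab ⟨⟨w, hwH⟩, Subtype.ext hw, fun h ↦ hw1 (congrArg Subtype.val h), hwa⟩
    (u := ⟨u, huH⟩) (v := ⟨v, hvH⟩)
    (Subtype.ext hu) (fun h ↦ hu1 (congrArg Subtype.val h)) hub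
    (Subtype.ext hv) (fun h ↦ hv1 (congrArg Subtype.val h)) hvb
  exact ⟨h, h.2, hha, hhb, congrArg Subtype.val hhc⟩

/-! ### `SL(2,K)` on the projective line in characteristic two -/

/-- The upper unitriangular matrix with corner entry `t`. -/
def upperUnip {R : Type*} [CommRing R] (t : R) : SpecialLinearGroup (Fin 2) R :=
  ⟨!![1, t; 0, 1], by simp⟩

/-- The lower unitriangular matrix with corner entry `t`. -/
def lowerUnip {R : Type*} [CommRing R] (t : R) : SpecialLinearGroup (Fin 2) R :=
  ⟨!![1, 0; t, 1], by simp⟩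

section FieldTwo

variable {K : Type*} [Field K]

theorem SL2_det (g : SpecialLinearGroup (Fin 2) K) : g 0 0 * g 1 1 - g 0 1 * g 1 0 = 1 := by
  rw [← det_fin_two, g.det_coe]

theorem toGL_smul_infty_eq_self_iff [DecidableEq K] (g : SpecialLinearGroup (Fin 2) K) :
    SpecialLinearGroup.toGL g • (OnePoint.infty : OnePoint K) = OnePoint.infty ↔ g 1 0 = 0 :=
  OnePoint.smul_infty_eq_self_iff

theorem toGL_smul_coe_eq_self_iff [DecidableEq K] (g : SpecialLinearGroup (Fin 2) K) (k : K) :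
    SpecialLinearGroup.toGL g • (k : OnePoint K) = k ↔
      g 0 0 * k + g 0 1 = k * (g 1 0 * k + g 1 1) := by
  have hd := SL2_det g
  rw [OnePoint.smul_some_eq_ite]
  change (if g 1 0 * k + g 1 1 = 0 then OnePoint.infty else
    (((g 0 0 * k + g 0 1) / (g 1 0 * k + g 1 1) : K) : OnePoint K)) = k ↔ _
  by_cases h : g 1 0 * k + g 1 1 = 0
  · rw [if_pos h]
    simp only [OnePoint.infty_ne_coe, false_iff]
    intro h'
    rw [h, mul_zero] at h'
    have : (1 : K) = 0 := by
      linear_combination (-1) * hd + g 0 0 * h - g 1 0 * h'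
    exact one_ne_zero this
  · rw [if_neg h, OnePoint.coe_eq_coe, div_eq_iff h]

section CharTwo

variable [CharP K 2]

theorem eq_of_sq_eq_sq_charTwo {x y : K} (h : x ^ 2 = y ^ 2) : x = y := by
  have h2 := CharTwo.two_eq_zero (R := K)
  have : (x - y) ^ 2 = 0 := by linear_combination h + (y ^ 2 - x * y) * h2
  exact sub_eq_zero.mp (pow_eq_zero_iff two_ne_zero |>.mp this)

theorem SL2_mul_self_eq_one_iff (g : SpecialLinearGroup (Fin 2) K) :
    g * g = 1 ↔ g 0 0 = g 1 1 := by
  have h2 := CharTwo.two_eq_zero (R := K)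
  have hd := SL2_det g
  constructor
  · intro h
    have h00 := congrArg (fun m : SpecialLinearGroup (Fin 2) K ↦ m 0 0) h
    have h01 := congrArg (fun m : SpecialLinearGroup (Fin 2) K ↦ m 0 1) h
    have h11 := congrArg (fun m : SpecialLinearGroup (Fin 2) K ↦ m 1 1) h
    simp [Matrix.mul_apply, Fin.sum_univ_two] at h00 h01 h11
    exact eq_of_sq_eq_sq_charTwo (by linear_combination h00 - h11)
  · intro h
    ext i j
    fin_cases i <;> fin_cases j <;> simp [Matrix.mul_apply, Fin.sum_univ_two]
    · linear_combination hd + g 0 0 * h + g 0 1 * g 1 0 * h2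
    · linear_combination g 0 1 * h + g 0 1 * g 1 1 * h2
    · linear_combination g 1 0 * h + g 1 0 * g 1 1 * h2
    · linear_combination hd - g 1 1 * h + g 0 1 * g 1 0 * h2

variable [DecidableEq K]

theorem SL2_involution_fixed_point (t : SpecialLinearGroup (Fin 2) K) (ht : t * t = 1)
    (ht1 : t ≠ 1) : ∃ x : OnePoint K, SpecialLinearGroup.toGL t • x = x ∧
      ∀ y : OnePoint K, SpecialLinearGroup.toGL t • y = y → y = x := by
  have h2 := CharTwo.two_eq_zero (R := K)
  have hd := SL2_det t
  rw [SL2_mul_self_eq_one_iff] at ht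
  by_cases hz : t 1 0 = 0
  · refine ⟨OnePoint.infty, (toGL_smul_infty_eq_self_iff t).mpr hz, fun y hy ↦ ?_⟩
    induction y using OnePoint.rec with
    | infty => rfl
    | coe k =>
      exfalso
      rw [toGL_smul_coe_eq_self_iff, hz] at hy
      have h01 : t 0 1 = 0 := by linear_combination hy - k * ht
      have h00 : t 0 0 = 1 := eq_of_sq_eq_sq_charTwo (by
        linear_combination hd + t 0 0 * ht + t 0 1 * hz)
      apply ht1
      ext i j
      fin_cases i <;> fin_cases j <;> simp [h01, hz, h00, ← ht]
  -- The only eigenvalue of `t` is one; this is the slope of the eigenvector, obtained from `t 1 0 *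
  -- k + t 1 1 = 1`.
  · refine ⟨((t 0 0 + 1) / t 1 0 : K), ?_, fun y hy ↦ ?_⟩
    · rw [toGL_smul_coe_eq_self_iff]
      field_simp
      linear_combination -hd - ht - (1 + t 1 1) * h2
    · induction y using OnePoint.rec with
      | infty => exact absurd ((toGL_smul_infty_eq_self_iff t).mp hy) hz
      | coe k =>
        rw [toGL_smul_coe_eq_self_iff] at hy
        rw [OnePoint.coe_eq_coe, eq_div_iff hz]
        refine eq_of_sq_eq_sq_charTwo ?_
        linear_combination -t 1 0 * hy + t 1 0 * k * ht - hd - t 0 0 * ht - (t 0 0 + 1) * h2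

/-- An involution `u` has equal diagonal entries. If those of `h` differed, commuting with `h` would
make `u` diagonal and hence trivial. So they agree, and then `h` squares to one; unless trivial, it
would have just one fixed point. -/
theorem SL2_eq_one_of_commute_involution (h u : SpecialLinearGroup (Fin 2) K) {a b : OnePoint K}
    (hab : a ≠ b) (ha : SpecialLinearGroup.toGL h • a = a)
    (hb : SpecialLinearGroup.toGL h • b = b) (hu : u * u = 1) (hu1 : u ≠ 1)
    (hc : h * u = u * h) : h = 1 := by
  have h2 := CharTwo.two_eq_zero (R := K)
  have hd := SL2_det u
  rw [SL2_mul_self_eq_one_iff] at hu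
  have hh : h 0 0 = h 1 1 := by
    by_contra hne
    have hne := sub_ne_zero.mpr hne
    have h01 := congrArg (fun m : SpecialLinearGroup (Fin 2) K ↦ m 0 1) hc
    have h10 := congrArg (fun m : SpecialLinearGroup (Fin 2) K ↦ m 1 0) hc
    simp [Matrix.mul_apply, Fin.sum_univ_two] at h01 h10
    have u01 : u 0 1 = 0 := by
      refine (mul_eq_zero.mp (?_ : (h 0 0 - h 1 1) * u 0 1 = 0)).resolve_left hne
      linear_combination h01 + h 0 1 * hu
    have u10 : u 1 0 = 0 := by
      refine (mul_eq_zero.mp (?_ : (h 0 0 - h 1 1) * u 1 0 = 0)).resolve_left hne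
      linear_combination (-1) * h10 + h 1 0 * hu
    have h00 : u 0 0 = 1 := eq_of_sq_eq_sq_charTwo (by
        linear_combination hd + u 0 0 * hu + u 0 1 * u10)
    apply hu1
    ext i j
    fin_cases i <;> fin_cases j <;> simp [u01, u10, h00, ← hu]
  by_contra h1
  obtain ⟨x, -, hx⟩ := SL2_involution_fixed_point h ((SL2_mul_self_eq_one_iff h).mpr hh) h1
  exact hab ((hx a ha).trans (hx b hb).symm)

end CharTwo

end FieldTwo

/-! ### Transvections generating `SL(2)` over a subfield -/

section FieldTwo

variable {K : Type*} [Field K]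

@[simp] theorem upperUnip_apply_00 (t : K) : (upperUnip t) 0 0 = 1 := rfl
@[simp] theorem upperUnip_apply_01 (t : K) : (upperUnip t) 0 1 = t := rfl
@[simp] theorem upperUnip_apply_10 (t : K) : (upperUnip t) 1 0 = 0 := rfl
@[simp] theorem upperUnip_apply_11 (t : K) : (upperUnip t) 1 1 = 1 := rfl
@[simp] theorem lowerUnip_apply_00 (t : K) : (lowerUnip t) 0 0 = 1 := rfl
@[simp] theorem lowerUnip_apply_01 (t : K) : (lowerUnip t) 0 1 = 0 := rfl
@[simp] theorem lowerUnip_apply_10 (t : K) : (lowerUnip t) 1 0 = t := rfl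
@[simp] theorem lowerUnip_apply_11 (t : K) : (lowerUnip t) 1 1 = 1 := rfl

theorem upperUnip_add (s t : K) : upperUnip (s + t) = upperUnip s * upperUnip t := by
  ext i j
  fin_cases i <;> fin_cases j <;> simp [Matrix.mul_apply, Fin.sum_univ_two, add_comm]

theorem upperUnip_zero : upperUnip (0 : K) = 1 := by
  ext i j
  fin_cases i <;> fin_cases j <;> simp

theorem upperUnip_neg (t : K) : upperUnip (-t) = (upperUnip t)⁻¹ := by
  rw [eq_inv_iff_mul_eq_one, ← upperUnip_add, neg_add_cancel, upperUnip_zero]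

theorem upperUnip_injective : Function.Injective (upperUnip : K → _) := fun _ _ h ↦
  congrArg (fun m : SpecialLinearGroup (Fin 2) K ↦ m 0 1) h

theorem lowerUnip_zero : lowerUnip (0 : K) = 1 := by
  ext i j
  fin_cases i <;> fin_cases j <;> simp

/-- Conjugating an upper unitriangular matrix by an upper triangular one. -/
theorem upperTri_mul_upperUnip (h : SpecialLinearGroup (Fin 2) K) (hh : h 1 0 = 0) (t : K) :
    h * upperUnip t * h⁻¹ = upperUnip (h 0 0 ^ 2 * t) := by
  have hd := SL2_det h
  rw [mul_inv_eq_iff_eq_mul]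
  ext i j
  fin_cases i <;> fin_cases j <;> simp [Matrix.mul_apply, Fin.sum_univ_two, hh]
  linear_combination (-h 0 0 * t) * hd - h 0 0 * t * h 0 1 * hh

variable [CharP K 2]

theorem upperUnip_mul_self (t : K) : upperUnip t * upperUnip t = 1 := by
  simp [SL2_mul_self_eq_one_iff]

theorem lowerUnip_mul_self (t : K) : lowerUnip t * lowerUnip t = 1 := by
  simp [SL2_mul_self_eq_one_iff]

variable [Finite K]

/-- Let `H` be a subgroup of `SL(2,K)` containing `upperUnip 1`, and `a` a point fixed by an
involution of `H`. Then the stabiliser of `a` and `∞` in `H` contains matrices whose upper left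
entry squares to any given `t ≠ 0` with `upperUnip t ∈ H`. -/
theorem exists_upperTri_mem [DecidableEq K] (H : Subgroup (SpecialLinearGroup (Fin 2) K))
    (h1 : upperUnip 1 ∈ H) {a : K} {g : SpecialLinearGroup (Fin 2) K} (hg : g ∈ H)
    (hgg : g * g = 1) (hg1 : g ≠ 1) (hga : SpecialLinearGroup.toGL g • (a : OnePoint K) = a)
    {t : K} (ht : upperUnip t ∈ H) (ht0 : t ≠ 0) :
    ∃ h ∈ H, h 1 0 = 0 ∧ h 0 0 ^ 2 = t ∧
      SpecialLinearGroup.toGL h • (a : OnePoint K) = a := by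
  have hup (s : K) : SpecialLinearGroup.toGL (upperUnip s) • (OnePoint.infty : OnePoint K) =
      OnePoint.infty := (toGL_smul_infty_eq_self_iff _).mpr rfl
  have hne (s : K) (hs : s ≠ 0) : upperUnip s ≠ 1 := fun h ↦
    hs (upperUnip_injective (h.trans upperUnip_zero.symm))
  have : Finite (OnePoint K) := inferInstanceAs (Finite (Option K))
  obtain ⟨h, hh, hha, hhi, hhc⟩ := exists_conj_eq_of_hom_smul_eq
    (X := OnePoint K) SpecialLinearGroup.toGL H SL2_involution_fixed_point
    (fun h u _ _ hxy hx hy hu hu1 hc ↦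
      SL2_eq_one_of_commute_involution h u hxy hx hy hu hu1 hc)
    (OnePoint.coe_ne_infty a) hg h1 ht hgg hg1 hga (upperUnip_mul_self 1) (hne 1 one_ne_zero)
    (hup 1) (upperUnip_mul_self t) (hne t ht0) (hup t)
  have h10 := (toGL_smul_infty_eq_self_iff h).mp hhi
  refine ⟨h, hh, h10, ?_, hha⟩
  have := upperUnip_injective ((upperTri_mul_upperUnip h h10 1).symm.trans hhc)
  simpa using this

/-- A subgroup of `SL(2,K)` generated by two commuting transvections and a third one is `SL(2,F)`
for a subfield `F` of `K`, when `K` is finite of characteristic two. -/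
theorem exists_subfield_closure_eq_range {c d : K} (hc0 : c ≠ 0) (hc1 : c ≠ 1) (hd0 : d ≠ 0) :
    ∃ F : Subfield K, Subgroup.closure {upperUnip 1, upperUnip c, lowerUnip d} =
      (SpecialLinearGroup.map (n := Fin 2) F.subtype).range := by
  classical
  have h2 := CharTwo.two_eq_zero (R := K)
  set H := Subgroup.closure {upperUnip 1, upperUnip c, lowerUnip d} with hH
  have hu1 : upperUnip 1 ∈ H := Subgroup.subset_closure (by simp)
  have huc : upperUnip c ∈ H := Subgroup.subset_closure (by simp)
  have hld : lowerUnip d ∈ H := Subgroup.subset_closure (by simp)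
  have hld1 : lowerUnip d ≠ 1 := fun h ↦
    hd0 (congrArg (fun m : SpecialLinearGroup (Fin 2) K ↦ m 1 0) h)
  -- The involution `lowerUnip d` fixes `0`, and the stabiliser of `0` and `∞` is diagonal.
  -- Conjugation by the resulting `h` multiplies corner entries by `t`, which makes the set of
  -- corner entries occurring in `H` closed under products and inverses.
  have diag {t : K} (ht : upperUnip t ∈ H) (ht0 : t ≠ 0) :
      ∃ h ∈ H, h 1 0 = 0 ∧ h 0 0 ^ 2 = t ∧ h 0 1 = 0 := by
    obtain ⟨h, hh, h10, h00, h0⟩ := exists_upperTri_mem H hu1 hld (lowerUnip_mul_self d) hld1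
      (a := 0) ((toGL_smul_coe_eq_self_iff _ _).mpr (by simp)) ht ht0
    refine ⟨h, hh, h10, h00, ?_⟩
    simpa using (toGL_smul_coe_eq_self_iff _ _).mp h0
  have hmul {s t : K} (hs : upperUnip s ∈ H) (ht : upperUnip t ∈ H) : upperUnip (s * t) ∈ H := by
    by_cases hs0 : s = 0
    · simp [hs0, upperUnip_zero]
    obtain ⟨h, hh, h10, h00, -⟩ := diag hs hs0
    rw [← h00, ← upperTri_mul_upperUnip h h10]
    exact H.mul_mem (H.mul_mem hh ht) (H.inv_mem hh)
  have hinv {t : K} (ht : upperUnip t ∈ H) : upperUnip t⁻¹ ∈ H := by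
    by_cases ht0 : t = 0
    · simp [ht0, upperUnip_zero]
    obtain ⟨h, hh, h10, h00, -⟩ := diag ht ht0
    have key : h⁻¹ * upperUnip 1 * h = upperUnip t⁻¹ := by
      have := upperTri_mul_upperUnip h h10 t⁻¹
      rw [h00, mul_inv_cancel₀ ht0] at this
      rw [← this]
      group
    rw [← key]
    exact H.mul_mem (H.mul_mem (H.inv_mem hh) hu1) hh
  let F : Subfield K :=
    { carrier := {t | upperUnip t ∈ H}
      mul_mem' := hmul
      one_mem' := hu1
      add_mem' := fun {s t} hs ht ↦ by
        simpa only [Set.mem_ofPred_eq, upperUnip_add] using H.mul_mem hs ht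
      zero_mem' := by simpa only [Set.mem_ofPred_eq, upperUnip_zero] using H.one_mem
      neg_mem' := fun {t} ht ↦ by
        simpa only [Set.mem_ofPred_eq, upperUnip_neg] using H.inv_mem ht
      inv_mem' := fun t ht ↦ hinv ht }
  have memF {t : K} : t ∈ F ↔ upperUnip t ∈ H := Iff.rfl
  have hcF : c ∈ F := huc
  -- Finite fixed points of involutions of `H` lie in `F`. Take `h` fixing `a` and `∞`, and `k`
  -- diagonal, both with upper left entry `c`. Then `k⁻¹ * h` is unitriangular, so `h 0 1 / c` is in
  -- `F`. Solving `h • a = a` for `a` divides by `1 + (c ^ 2)⁻¹`, which is nonzero as `c ≠ 1`.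
  have point {a : K} {g : SpecialLinearGroup (Fin 2) K} (hg : g ∈ H) (hgg : g * g = 1)
      (hg1 : g ≠ 1) (hga : SpecialLinearGroup.toGL g • (a : OnePoint K) = a) : a ∈ F := by
    have hc2 : upperUnip (c ^ 2) ∈ H := F.pow_mem hcF 2
    have hc20 : c ^ 2 ≠ 0 := pow_ne_zero _ hc0
    obtain ⟨h, hh, h10, h00, hha⟩ := exists_upperTri_mem H hu1 hg hgg hg1 hga hc2 hc20
    obtain ⟨k, hk, k10, k00, k01⟩ := diag hc2 hc20
    replace h00 := eq_of_sq_eq_sq_charTwo h00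
    replace k00 := eq_of_sq_eq_sq_charTwo k00
    have hdh := SL2_det h
    have hdk := SL2_det k
    rw [toGL_smul_coe_eq_self_iff] at hha
    rw [h00, h10] at hdh hha
    rw [k00, k10] at hdk
    have hprod : h = k * upperUnip (h 0 1 / c) := by
      ext i j
      fin_cases i <;> fin_cases j <;>
        simp [Matrix.mul_apply, Fin.sum_univ_two, h00, k00, k01, h10, k10]
      · field_simp
      · exact mul_left_cancel₀ hc0 (by linear_combination hdh - hdk)
    have hx : h 0 1 / c ∈ F := by
      rw [memF, ← inv_mul_eq_iff_eq_mul.mpr hprod]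
      exact H.mul_mem (H.inv_mem hk) hh
    have ha : a = h 0 1 / c / (1 + (c ^ 2)⁻¹) := by
      have hne : 1 + (c ^ 2)⁻¹ ≠ 0 := by
        intro h0
        apply hc1
        apply eq_of_sq_eq_sq_charTwo
        field_simp at h0
        linear_combination h0 - h2
      rw [eq_div_iff hne]
      field_simp
      linear_combination (-c) * hha - a * hdh + a * c ^ 2 * h2
    rw [ha]
    exact F.div_mem hx (F.add_mem F.one_mem (F.inv_mem (F.pow_mem hcF 2)))
  have hdF : d ∈ F := by
    rw [← inv_inv d]
    -- This involution is the conjugate of `upperUnip 1` by `lowerUnip d`, which sends `∞` to `d⁻¹`.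
    refine F.inv_mem (point (a := d⁻¹) (g := lowerUnip d * upperUnip 1 * lowerUnip d)
      (H.mul_mem (H.mul_mem hld hu1) hld) ?_ ?_ ?_)
    · rw [SL2_mul_self_eq_one_iff]
      simp [Matrix.mul_apply, Fin.sum_univ_two, add_comm]
    · intro h
      have := congrArg (fun m : SpecialLinearGroup (Fin 2) K ↦ m 0 1) h
      simp [Matrix.mul_apply, Fin.sum_univ_two] at this
    · rw [toGL_smul_coe_eq_self_iff]
      simp [Matrix.mul_apply, Fin.sum_univ_two]
      field_simp
      linear_combination -h2
  refine ⟨F, le_antisymm ?_ ?_⟩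
  · rw [hH, Subgroup.closure_le]
    have hmap (t : F) : SpecialLinearGroup.map F.subtype (upperUnip t) = upperUnip (t : K) := by
      ext i j
      fin_cases i <;> fin_cases j <;> simp
    have hmap' (t : F) : SpecialLinearGroup.map F.subtype (lowerUnip t) = lowerUnip (t : K) := by
      ext i j
      fin_cases i <;> fin_cases j <;> simp
    rintro g (rfl | rfl | rfl)
    · exact ⟨upperUnip 1, hmap 1⟩
    · exact ⟨upperUnip ⟨c, hcF⟩, hmap _⟩
    · exact ⟨lowerUnip ⟨d, hdF⟩, hmap' _⟩
  · rintro _ ⟨g, rfl⟩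
    refine SL2.transvection_induction (fun g ↦ SpecialLinearGroup.map F.subtype g ∈ H)
      (fun i j hij s ↦ ?_) (fun A B hA hB ↦ ?_) g
    · have hs : upperUnip (s : K) ∈ H := s.2
      by_cases hi : i = 0
      · subst hi
        obtain rfl : j = 1 := by omega
        convert hs
        ext i j
        fin_cases i <;> fin_cases j <;> simp [SpecialLinearGroup.transvection_coe]
      · obtain rfl : i = 1 := by omega
        obtain rfl : j = 0 := by omega
        have : SpecialLinearGroup.map F.subtype (SpecialLinearGroup.transvection hij s) =
            lowerUnip (s : K) := by
          ext i j
          fin_cases i <;> fin_cases j <;> simp [SpecialLinearGroup.transvection_coe]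
        rw [this]
        by_cases hs0 : (s : K) = 0
        · rw [hs0, lowerUnip_zero]
          exact H.one_mem
        -- A diagonal `h` divides lower corner entries by `h 0 0 ^ 2`, so `d / s` is the square that
        -- turns `d` into `s`.
        obtain ⟨h, hh, h10, h00, h01⟩ := diag (F.div_mem hdF s.2) (div_ne_zero hd0 hs0)
        have hdh := SL2_det h
        have key : lowerUnip (s : K) = h * lowerUnip d * h⁻¹ := by
          rw [eq_mul_inv_iff_mul_eq]
          ext i j
          fin_cases i <;> fin_cases j <;> simp [Matrix.mul_apply, Fin.sum_univ_two, h10, h01]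
          refine mul_left_cancel₀ (a := h 0 0) (fun h0 ↦ ?_) ?_
          · rw [h0, h10] at hdh
            simp at hdh
          · rw [h01] at hdh
            rw [eq_div_iff hs0] at h00
            linear_combination h00 - d * hdh
        rw [key]
        exact H.mul_mem (H.mul_mem hh hld) (H.inv_mem hh)
    · rw [map_mul]
      exact H.mul_mem hA hB

end FieldTwo

/-! ### The orthogonal group of the ternary form in characteristic two -/

section Orthogonal

variable {K : Type*} [Field K]

/-- An element of `SL(3,K)` with the middle diagonal entry one is not a nontrivial scalar. -/
theorem SL3_eq_one_of_mem_center {A : SpecialLinearGroup (Fin 3) K}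
    (hA : A ∈ Subgroup.center (SpecialLinearGroup (Fin 3) K)) (h1 : A 1 1 = 1) : A = 1 := by
  obtain ⟨r, -, hr⟩ := Matrix.SpecialLinearGroup.mem_center_iff.mp hA
  have : r = 1 := by
    rw [← h1, ← hr]
    simp
  ext i j
  rw [← hr, this]
  simp

variable [CharP K 2]

theorem nonempty_SL2_mulEquiv_PSL2 :
    Nonempty (SpecialLinearGroup (Fin 2) K ≃* ProjectiveSpecialLinearGroup (Fin 2) K) := by
  have hc : Subgroup.center (SpecialLinearGroup (Fin 2) K) = ⊥ := by
    rw [eq_bot_iff]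
    intro A hA
    obtain ⟨r, hr2, hr⟩ := Matrix.SpecialLinearGroup.mem_center_iff.mp hA
    have : r = 1 := eq_of_sq_eq_sq_charTwo (by simpa using hr2)
    rw [Subgroup.mem_bot]
    ext i j
    rw [← hr, this]
    simp
  exact ⟨(QuotientGroup.quotientBot.symm).trans
    (QuotientGroup.quotientMulEquivOfEq hc.symm)⟩

variable [Finite K]

/-- The square root in a finite field of characteristic two. -/
noncomputable def charTwoSqrt (K : Type*) [Field K] [CharP K 2] [Finite K] : K ≃+* K :=
  have : Fact (Nat.Prime 2) := ⟨Nat.prime_two⟩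
  (frobeniusEquiv K 2).symm

theorem charTwoSqrt_sq (x : K) : charTwoSqrt K x ^ 2 = x := by
  have : Fact (Nat.Prime 2) := ⟨Nat.prime_two⟩
  exact frobeniusEquiv_symm_pow_p K 2 x

/-- The matrix acting as `g` modulo the second basis vector and fixing that vector, with the
remaining entries chosen, for `s = 1`, to preserve the ternary form. -/
noncomputable def orthogonalMatrix (s : K) (g : SpecialLinearGroup (Fin 2) K) :
    Matrix (Fin 3) (Fin 3) K :=
  !![g 0 0, 0, g 0 1;
    s * charTwoSqrt K (g 0 0 * g 1 0), 1, s * charTwoSqrt K (g 0 1 * g 1 1);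
    g 1 0, 0, g 1 1]

theorem det_orthogonalMatrix (s : K) (g : SpecialLinearGroup (Fin 2) K) :
    (orthogonalMatrix s g).det = 1 := by
  have := SL2_det g
  simp only [orthogonalMatrix, det_fin_three, of_apply, cons_val', cons_val_zero, cons_val_one,
    cons_val]
  linear_combination this

theorem orthogonalMatrix_one (s : K) : orthogonalMatrix s 1 = 1 := by
  ext i j
  fin_cases i <;> fin_cases j <;> simp [orthogonalMatrix]

theorem orthogonalMatrix_mul (s : K) (g h : SpecialLinearGroup (Fin 2) K) :
    orthogonalMatrix s (g * h) = orthogonalMatrix s g * orthogonalMatrix s h := by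
  have h2 := CharTwo.two_eq_zero (R := K)
  have hg := congrArg (charTwoSqrt K) (SL2_det g)
  rw [map_sub, map_mul, map_mul, map_one] at hg
  ext i j
  fin_cases i <;> fin_cases j <;>
    simp [orthogonalMatrix, Matrix.mul_apply, Fin.sum_univ_two, Fin.sum_univ_three]
  · have e0 := charTwoSqrt_sq (h 0 0)
    have e1 := charTwoSqrt_sq (h 1 0)
    generalize charTwoSqrt K (h 0 0) = P at *
    generalize charTwoSqrt K (h 1 0) = R at *
    generalize charTwoSqrt K (g 0 0) = p at *
    generalize charTwoSqrt K (g 0 1) = q at *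
    generalize charTwoSqrt K (g 1 0) = r at *
    generalize charTwoSqrt K (g 1 1) = t at *
    linear_combination s * p * r * e0 + s * q * t * e1 + s * P * R * hg + s * P * R * q * r * h2
  · have e0 := charTwoSqrt_sq (h 0 1)
    have e1 := charTwoSqrt_sq (h 1 1)
    generalize charTwoSqrt K (h 0 1) = P at *
    generalize charTwoSqrt K (h 1 1) = R at *
    generalize charTwoSqrt K (g 0 0) = p at *
    generalize charTwoSqrt K (g 0 1) = q at *
    generalize charTwoSqrt K (g 1 0) = r at *
    generalize charTwoSqrt K (g 1 1) = t at *
    linear_combination s * p * r * e0 + s * q * t * e1 + s * P * R * hg + s * P * R * q * r * h2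

/-- For `s = 1` the standard embedding of `SL(2,K)` as the orthogonal group of the ternary form,
for `s = 0` the block diagonal embedding; the embeddings for `s ≠ 0` are conjugate. -/
noncomputable def orthogonalHom (s : K) :
    SpecialLinearGroup (Fin 2) K →* SpecialLinearGroup (Fin 3) K where
  toFun g := ⟨orthogonalMatrix s g, det_orthogonalMatrix s g⟩
  map_one' := Subtype.ext (orthogonalMatrix_one s)
  map_mul' g h := Subtype.ext (orthogonalMatrix_mul s g h)

theorem orthogonalHom_coe (s : K) (g : SpecialLinearGroup (Fin 2) K) :
    (orthogonalHom s g : Matrix (Fin 3) (Fin 3) K) = orthogonalMatrix s g := rfl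

theorem orthogonalHom_injective (s : K) : Function.Injective (orthogonalHom s) := by
  intro g h hgh
  have key := congrArg Subtype.val hgh
  rw [orthogonalHom_coe, orthogonalHom_coe] at key
  have h00 := congrFun (congrFun key 0) 0
  have h02 := congrFun (congrFun key 0) 2
  have h20 := congrFun (congrFun key 2) 0
  have h22 := congrFun (congrFun key 2) 2
  simp [orthogonalMatrix] at h00 h02 h20 h22
  ext i j
  fin_cases i <;> fin_cases j <;> simpa

/-- In characteristic two the polar form is alternating with radical spanned by the second basis
vector. An isometry therefore fixes that vector and induces a symplectic map, that is an element of
`SL(2,K)`, on the quotient. The rest of the middle row is determined by square roots, since the form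
has value `x₁²` on the radical. -/
theorem orthogonalHom_one_range : (orthogonalHom (1 : K)).range = SO3 K := by
  have h2 := CharTwo.two_eq_zero (R := K)
  ext A
  constructor
  · rintro ⟨g, rfl⟩ v
    have hd := SL2_det g
    rw [orthogonalHom_coe]
    simp [ternaryForm, orthogonalMatrix, Matrix.mulVec, dotProduct, Fin.sum_univ_three, -map_mul]
    have e1 := charTwoSqrt_sq (g 0 0 * g 1 0)
    have e2 := charTwoSqrt_sq (g 0 1 * g 1 1)
    generalize charTwoSqrt K (g 0 0 * g 1 0) = x at *
    generalize charTwoSqrt K (g 0 1 * g 1 1) = y at *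
    linear_combination v 0 ^ 2 * e1 + v 2 ^ 2 * e2 + v 0 * v 2 * hd + (v 0 ^ 2 * g 0 0 * g 1 0 +
      v 2 ^ 2 * g 0 1 * g 1 1 + v 0 * v 2 * g 0 1 * g 1 0 + x * y * v 0 * v 2 + x * v 0 * v 1 +
      y * v 1 * v 2) * h2
  · intro hA
    have hv := fun v ↦ hA v
    simp only [ternaryForm, Matrix.mulVec, dotProduct, Fin.sum_univ_three] at hv
    have q0 := hv ![1, 0, 0]
    have q1 := hv ![0, 1, 0]
    have q2 := hv ![0, 0, 1]
    have q01 := hv ![1, 1, 0]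
    have q12 := hv ![0, 1, 1]
    have q02 := hv ![1, 0, 1]
    simp at q0 q1 q2 q01 q12 q02
    have p01 : A 0 0 * A 2 1 + A 0 1 * A 2 0 = 0 := by
      linear_combination q01 - q0 - q1 - A 1 0 * A 1 1 * h2
    have p12 : A 0 1 * A 2 2 + A 0 2 * A 2 1 = 0 := by
      linear_combination q12 - q1 - q2 - A 1 1 * A 1 2 * h2
    have p02 : A 0 0 * A 2 2 + A 0 2 * A 2 0 = 1 := by
      linear_combination q02 - q0 - q2 - A 1 0 * A 1 2 * h2
    have a01 : A 0 1 = 0 := by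
      linear_combination (-A 0 1) * p02 + A 0 0 * p12 + A 0 2 * p01 - A 0 0 * A 0 2 * A 2 1 * h2
    have a21 : A 2 1 = 0 := by
      linear_combination (-A 2 1) * p02 + A 2 2 * p01 + A 2 0 * p12 - A 2 2 * A 2 0 * A 0 1 * h2
    have a11 : A 1 1 = 1 := eq_of_sq_eq_sq_charTwo (by rw [a01] at q1; linear_combination q1)
    refine ⟨⟨!![A 0 0, A 0 2; A 2 0, A 2 2], ?_⟩, ?_⟩
    · rw [det_fin_two_of]
      linear_combination p02 - A 0 2 * A 2 0 * h2
    · have a10 : charTwoSqrt K (A 0 0 * A 2 0) = A 1 0 := eq_of_sq_eq_sq_charTwo (by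
        rw [charTwoSqrt_sq]; linear_combination q0 - A 1 0 ^ 2 * h2)
      have a12 : charTwoSqrt K (A 0 2 * A 2 2) = A 1 2 := eq_of_sq_eq_sq_charTwo (by
        rw [charTwoSqrt_sq]; linear_combination q2 - A 1 2 ^ 2 * h2)
      refine Subtype.ext ((orthogonalHom_coe _ _).trans ?_)
      ext i j
      fin_cases i <;> fin_cases j <;> simp [orthogonalMatrix, a01, a21, a11, a10, a12, -map_mul]

theorem nonempty_SL2_mulEquiv_PSO3 :
    Nonempty (SpecialLinearGroup (Fin 2) K ≃* PSO3 K) := by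
  let ψ := (QuotientGroup.mk' (Subgroup.center (SpecialLinearGroup (Fin 3) K))).comp
    (orthogonalHom (1 : K))
  have hψ : Function.Injective ψ := by
    rw [injective_iff_map_eq_one]
    intro g hg
    have := (QuotientGroup.eq_one_iff _).mp hg
    have := SL3_eq_one_of_mem_center this rfl
    exact orthogonalHom_injective 1 (this.trans (map_one _).symm)
  have hr : ψ.range = PSO3 K := by
    rw [MonoidHom.range_comp, orthogonalHom_one_range]
    rfl
  exact ⟨(MonoidHom.ofInjective hψ).trans (MulEquiv.subgroupCongr hr)⟩

end Orthogonal

/-! ### Dihedral groups generated by two involutions -/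

section Dihedral

/-- The powers of `x`, indexed by the integers modulo its order. -/
theorem exists_zmod_pow {Γ : Type*} [Group Γ] (x : Γ) :
    ∃ f : ZMod (orderOf x) → Γ, (∀ i j, f (i + j) = f i * f j) ∧
      ∀ n : ℤ, f n = x ^ n := by
  let z : ℤ →+ Additive Γ := zmultiplesHom (Additive Γ) (Additive.ofMul x)
  have hz : z (orderOf x : ℤ) = 0 := by
    change x ^ (orderOf x : ℤ) = 1
    rw [zpow_natCast, pow_orderOf_eq_one]
  refine ⟨fun i ↦ (ZMod.lift (orderOf x) ⟨z, hz⟩ i).toMul, fun i j ↦ ?_, fun n ↦ ?_⟩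
  · simp
  · simp [z]

/-- Two non-commuting involutions generate a dihedral group. -/
theorem exists_dihedral_hom {Γ : Type*} [Group Γ] {a b : Γ} (ha : a * a = 1) (hb : b * b = 1)
    (hab : a * b ≠ b * a) :
    ∃ f : DihedralGroup (orderOf (a * b)) →* Γ, Function.Injective f ∧
      f (.sr 0) = a ∧ f (.sr 1) = b ∧ ∀ g, f g ∈ Subgroup.closure {a, b} := by
  obtain ⟨F, hadd, hF⟩ := exists_zmod_pow (a * b)
  have hF0 : F 0 = 1 := by simpa using hF 0
  have hF1 : F 1 = a * b := by simpa using hF 1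
  have hconj (i : ZMod (orderOf (a * b))) : F i * a = a * F (-i) := by
    obtain ⟨n, rfl⟩ := ZMod.intCast_surjective i
    rw [← Int.cast_neg, hF, hF]
    have ha' : a⁻¹ = a := inv_eq_of_mul_eq_one_left ha
    have h1 : a⁻¹ * (a * b) * a⁻¹⁻¹ = (a * b)⁻¹ := by
      rw [_root_.mul_inv_rev, ha', ha', inv_eq_of_mul_eq_one_left hb, ← mul_assoc, ha, one_mul]
    have h2 : a⁻¹ * (a * b) ^ n * a⁻¹⁻¹ = (a * b) ^ (-n) := by
      rw [← conj_zpow, h1, _root_.inv_zpow, _root_.zpow_neg]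
    rw [← h2]
    group
  have hFinj (i) (h : F i = 1) : i = 0 := by
    obtain ⟨n, rfl⟩ := ZMod.intCast_surjective i
    rw [hF, ← orderOf_dvd_iff_zpow_eq_one] at h
    exact (ZMod.intCast_zmod_eq_zero_iff_dvd _ _).mpr h
  let f : DihedralGroup (orderOf (a * b)) →* Γ :=
    { toFun := fun g ↦ match g with
        | .r i => F i
        | .sr i => a * F i
      map_one' := hF0
      map_mul' := by
        rintro (i | i) (j | j)
        · exact hadd i j
        · change a * F (j - i) = F i * (a * F j)
          rw [← mul_assoc, hconj, mul_assoc, ← hadd, neg_add_eq_sub]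
        · change a * F (i + j) = a * F i * F j
          rw [hadd, mul_assoc]
        · change F (j - i) = a * F i * (a * F j)
          rw [mul_assoc, ← mul_assoc (F i), hconj, mul_assoc, ← hadd, ← mul_assoc, ha, one_mul,
            neg_add_eq_sub] }
  refine ⟨f, ?_, ?_, ?_, ?_⟩
  · rw [injective_iff_map_eq_one]
    rintro (i | i) h
    · rw [hFinj i h]
      rfl
    -- A reflection in the kernel would put `a` among the powers of `a * b`; then `a` commutes with
    -- `a * b`, hence with `b`.
    · exfalso
      replace h : a * F i = 1 := h
      have hc : a = F (-i) := by
        rw [← mul_right_inj (F i), ← hadd, add_neg_cancel, hF0, hconj]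
        have := hconj (-i)
        rw [neg_neg, h] at this
        have h' : F (-i) = a := by
          rw [← mul_left_inj a, this, ha]
        rw [h', ha]
      obtain ⟨n, hn⟩ := ZMod.intCast_surjective (-i)
      rw [← hn, hF] at hc
      have hcomm : Commute a (a * b) := by
        rw [hc, ← hc]
        nth_rw 1 [hc]
        exact (Commute.refl (a * b)).zpow_left n
      apply hab
      have := hcomm.eq
      rw [← mul_assoc, ha, one_mul, mul_assoc] at this
      calc a * b = a * (a * (b * a)) := by rw [← this]
        _ = b * a := by rw [← mul_assoc, ha, one_mul]
  · change a * F 0 = a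
    rw [hF0, mul_one]
  · change a * F 1 = b
    rw [hF1, ← mul_assoc, ha, one_mul]
  · have hmem (i) : F i ∈ Subgroup.closure {a, b} := by
      obtain ⟨n, rfl⟩ := ZMod.intCast_surjective i
      rw [hF]
      exact Subgroup.zpow_mem _ (Subgroup.mul_mem _ (Subgroup.subset_closure (by simp))
        (Subgroup.subset_closure (by simp))) n
    rintro (i | i)
    · exact hmem i
    · exact Subgroup.mul_mem _ (Subgroup.subset_closure (by simp)) (hmem i)

end Dihedral

/-! ### Eigenvalues and the order of a product of two transvections -/

section Order

variable {L : Type*} [Field L] [CharP L 2]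

/-- The order of the product of two transvections is that of its eigenvalues. -/
theorem exists_eigenvalue {d : L} (hd : d ≠ 0) :
    ∃ l : AlgebraicClosure L, l ^ 2 + algebraMap L _ d * l + 1 = 0 ∧
      ∀ n : ℕ, (upperUnip 1 * lowerUnip d : SpecialLinearGroup (Fin 2) L) ^ n = 1 ↔ l ^ n = 1 := by
  have : CharP (AlgebraicClosure L) 2 := charP_of_injective_algebraMap
    (algebraMap L (AlgebraicClosure L)).injective 2
  have h2 := CharTwo.two_eq_zero (R := AlgebraicClosure L)
  set D := algebraMap L (AlgebraicClosure L) d with hD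
  have hD0 : D ≠ 0 := by simpa [hD] using hd
  obtain ⟨l, hl⟩ : ∃ l : AlgebraicClosure L, l ^ 2 + D * l + 1 = 0 := by
    obtain ⟨l, hl⟩ := IsAlgClosed.exists_root
      (Polynomial.X ^ 2 + Polynomial.C D * Polynomial.X + 1 : Polynomial (AlgebraicClosure L))
      (by
        have : (Polynomial.X ^ 2 + Polynomial.C D * Polynomial.X + 1 :
          Polynomial (AlgebraicClosure L)).degree = 2 := by compute_degree!
        rw [this]; norm_num)
    exact ⟨l, by simpa [Polynomial.IsRoot] using hl⟩
  have hl0 : l ≠ 0 := by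
    rintro rfl
    simp at hl
  refine ⟨l, hl, fun n ↦ ?_⟩
  let G : Matrix (Fin 2) (Fin 2) (AlgebraicClosure L) := !![1 + D, 1; D, 1]
  -- The columns are eigenvectors for `l` and `l⁻¹`, which differ because `l + l⁻¹ = d ≠ 0` in
  -- characteristic two.
  let P : Matrix (Fin 2) (Fin 2) (AlgebraicClosure L) := !![1, 1; l + 1 + D, l⁻¹ + 1 + D]
  let E : Matrix (Fin 2) (Fin 2) (AlgebraicClosure L) := diagonal ![l, l⁻¹]
  have hdet : IsUnit P.det := by
    rw [isUnit_iff_ne_zero, det_fin_two_of]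
    intro h
    apply hD0
    field_simp at h
    have : l * D = 0 := by linear_combination h + hl - h2
    exact (mul_eq_zero.mp this).resolve_left hl0
  have hGP : G * P = P * E := by
    ext i j
    fin_cases i <;> fin_cases j <;> simp [G, P, E, Matrix.mul_apply, Fin.sum_univ_two]
    · linear_combination (1 + D) * h2
    · linear_combination (1 + D) * h2
    · linear_combination -hl + (D + 1) * h2
    · field_simp
      linear_combination hl + (l ^ 2 * D - l * D - 1) * h2
  have hpow : G ^ n * P = P * E ^ n := by
    induction n with
    | zero => simp
    | succ n ih => rw [pow_succ, pow_succ, mul_assoc, hGP, ← mul_assoc, ih, mul_assoc]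
  have hE : E ^ n = 1 ↔ l ^ n = 1 := by
    rw [diagonal_pow, ← diagonal_one, diagonal_eq_diagonal_iff]
    constructor
    · intro h
      simpa using h 0
    · intro h i
      fin_cases i <;> simp [h]
  have hGE : G ^ n = 1 ↔ E ^ n = 1 := by
    constructor
    · intro h
      rw [h, one_mul] at hpow
      have := congrArg (P⁻¹ * ·) hpow
      simpa [← mul_assoc, nonsing_inv_mul P hdet] using this.symm
    · intro h
      rw [h, mul_one] at hpow
      have := congrArg (· * P⁻¹) hpow
      simpa [mul_assoc, mul_nonsing_inv P hdet] using this
  rw [← hE, ← hGE]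
  let φ := SpecialLinearGroup.map (n := Fin 2) (algebraMap L (AlgebraicClosure L))
  have hφ : ((φ (upperUnip 1 * lowerUnip d) : SpecialLinearGroup (Fin 2) _) :
      Matrix (Fin 2) (Fin 2) (AlgebraicClosure L)) = G := by
    rw [map_mul, Matrix.SpecialLinearGroup.coe_mul]
    ext i j
    fin_cases i <;> fin_cases j <;> simp [φ, G, Matrix.mul_apply, Fin.sum_univ_two, hD]
  have hinj : Function.Injective φ := by
    intro x y hxy
    ext i j
    have := congrArg (fun m : SpecialLinearGroup (Fin 2) (AlgebraicClosure L) ↦ m i j) hxy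
    exact (algebraMap L (AlgebraicClosure L)).injective this
  rw [← hinj.eq_iff, map_pow, map_one, ← hφ, ← Matrix.SpecialLinearGroup.coe_pow,
    ← Matrix.SpecialLinearGroup.coe_one]
  exact Subtype.ext_iff

/-- The `|L|`-power map fixes the coefficients of `X² + dX + 1`, so it sends the root `l` to `l` or
to the other root `l⁻¹`. -/
theorem orderOf_dvd_card_pred_or_succ [Finite L] {d : L} (hd : d ≠ 0) :
    orderOf (upperUnip 1 * lowerUnip d : SpecialLinearGroup (Fin 2) L) ∣ Nat.card L - 1 ∨
      orderOf (upperUnip 1 * lowerUnip d : SpecialLinearGroup (Fin 2) L) ∣ Nat.card L + 1 := by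
  have := Fintype.ofFinite L
  obtain ⟨l, hl, hn⟩ := exists_eigenvalue hd
  have : CharP (AlgebraicClosure L) 2 := charP_of_injective_algebraMap
    (algebraMap L (AlgebraicClosure L)).injective 2
  have : Fact (Nat.Prime 2) := ⟨Nat.prime_two⟩
  obtain ⟨m, -, hm⟩ := FiniteField.card L 2
  have hl0 : l ≠ 0 := by
    rintro rfl
    simp at hl
  have hfrob : (l ^ Nat.card L) ^ 2 + algebraMap L _ d * l ^ Nat.card L + 1 = 0 := by
    have h := congrArg (fun x ↦ x ^ (2 ^ (m : ℕ))) hl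
    simp only [add_pow_char_pow, mul_pow, one_pow] at h
    rw [← hm, ← map_pow, FiniteField.pow_card, zero_pow Fintype.card_ne_zero,
      ← Nat.card_eq_fintype_card] at h
    rw [← h]
    ring
  rw [orderOf_dvd_iff_pow_eq_one, orderOf_dvd_iff_pow_eq_one, hn, hn]
  have key : (l ^ Nat.card L - l) * (l ^ Nat.card L * l - 1) = 0 := by
    linear_combination l * hfrob - l ^ Nat.card L * hl
  rcases mul_eq_zero.mp key with h | h
  · left
    apply mul_right_cancel₀ hl0
    rw [← pow_succ, Nat.sub_add_cancel Nat.card_pos, one_mul]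
    exact sub_eq_zero.mp h
  · right
    rw [pow_succ]
    exact sub_eq_zero.mp h

/-- Here the `2 ^ j`-power map preserves the pair `l`, `l⁻¹`, and hence fixes its sum `d`. -/
theorem pow_eq_self_of_orderOf_dvd {d : L} (hd : d ≠ 0) (j : ℕ)
    (h : orderOf (upperUnip 1 * lowerUnip d : SpecialLinearGroup (Fin 2) L) ∣ 2 ^ j - 1 ∨
      orderOf (upperUnip 1 * lowerUnip d : SpecialLinearGroup (Fin 2) L) ∣ 2 ^ j + 1) :
    d ^ 2 ^ j = d := by
  obtain ⟨l, hl, hn⟩ := exists_eigenvalue hd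
  have : CharP (AlgebraicClosure L) 2 := charP_of_injective_algebraMap
    (algebraMap L (AlgebraicClosure L)).injective 2
  have : Fact (Nat.Prime 2) := ⟨Nat.prime_two⟩
  have hl0 : l ≠ 0 := by
    rintro rfl
    simp at hl
  have hfrob := congrArg (fun x ↦ x ^ (2 ^ j)) hl
  simp only [add_pow_char_pow, mul_pow, one_pow] at hfrob
  rw [zero_pow (by positivity), ← pow_mul, mul_comm 2, pow_mul] at hfrob
  apply (algebraMap L (AlgebraicClosure L)).injective
  rw [map_pow]
  simp only [orderOf_dvd_iff_pow_eq_one, hn] at h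
  rcases h with h | h
  · have h' : l ^ 2 ^ j = l := by
      calc l ^ 2 ^ j = l ^ (2 ^ j - 1) * l := by rw [← pow_succ, Nat.sub_add_cancel Nat.one_le_two_pow]
        _ = l := by rw [h, one_mul]
    rw [h'] at hfrob
    exact mul_right_cancel₀ hl0 (by linear_combination hfrob - hl)
  · rw [pow_succ] at h
    apply mul_left_cancel₀ hl0
    generalize l ^ 2 ^ j = m at *
    linear_combination l ^ 2 * hfrob - hl -
      (algebraMap L (AlgebraicClosure L) d ^ 2 ^ j * l + l * m + 1) * h

end Order

/-! ### Elations with a fixed centre and the action of `SL(2)` on them -/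

section Affine

variable {K : Type*} [Field K]

/-- The matrix of an elation whose centre is the second basis vector. -/
def elationMatrix (r : Fin 2 → K) : Matrix (Fin 3) (Fin 3) K := !![1, 0, 0; r 0, 1, r 1; 0, 0, 1]

theorem elationMatrix_zero : elationMatrix (0 : Fin 2 → K) = 1 := by
  ext i j
  fin_cases i <;> fin_cases j <;> simp [elationMatrix]

theorem elationMatrix_add (r t : Fin 2 → K) :
    elationMatrix (r + t) = elationMatrix r * elationMatrix t := by
  ext i j
  fin_cases i <;> fin_cases j <;>
    simp [elationMatrix, Matrix.mul_apply, Fin.sum_univ_three, add_comm]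

/-- The elations with centre the second basis vector, scaled by `s`. -/
def elationHom (s : K) : Multiplicative (Fin 2 → K) →* SpecialLinearGroup (Fin 3) K where
  toFun r := ⟨elationMatrix (s • r.toAdd), by simp [elationMatrix, det_fin_three]⟩
  map_one' := Subtype.ext ((congrArg _ (smul_zero s)).trans elationMatrix_zero)
  map_mul' r t := Subtype.ext (by
    change elationMatrix (s • (r.toAdd + t.toAdd)) =
      elationMatrix (s • r.toAdd) * elationMatrix (s • t.toAdd)
    rw [smul_add, elationMatrix_add])

theorem elationHom_coe (s : K) (r : Multiplicative (Fin 2 → K)) :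
    (elationHom s r : Matrix (Fin 3) (Fin 3) K) = elationMatrix (s • r.toAdd) := rfl

/-- `SL(2,F)` acting on row vectors through the inverse. -/
def rowAction (F : Type*) [Field F] :
    SpecialLinearGroup (Fin 2) F →* MulAut (Multiplicative (Fin 2 → F)) where
  toFun g :=
    { toFun := fun r ↦ .ofAdd (r.toAdd ᵥ* (g⁻¹ : SpecialLinearGroup (Fin 2) F).1)
      invFun := fun r ↦ .ofAdd (r.toAdd ᵥ* g.1)
      left_inv := fun r ↦ by
        simp [vecMul_vecMul, ← Matrix.SpecialLinearGroup.coe_mul, -Matrix.SpecialLinearGroup.coe_inv]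
      right_inv := fun r ↦ by
        simp [vecMul_vecMul, ← Matrix.SpecialLinearGroup.coe_mul, -Matrix.SpecialLinearGroup.coe_inv]
      map_mul' := fun r t ↦ by
        simp [add_vecMul, ofAdd_add] }
  map_one' := by
    ext r : 1
    simp
  map_mul' g h := by
    ext r : 1
    simp [vecMul_vecMul, ← Matrix.SpecialLinearGroup.coe_mul, -Matrix.SpecialLinearGroup.coe_inv]

theorem rowAction_apply {F : Type*} [Field F] (g : SpecialLinearGroup (Fin 2) F)
    (r : Fin 2 → F) : (rowAction F g (.ofAdd r)).toAdd =
      r ᵥ* (g⁻¹ : SpecialLinearGroup (Fin 2) F).1 := rfl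

theorem rowAction_injective (F : Type*) [Field F] : Function.Injective (rowAction F) := by
  rw [injective_iff_map_eq_one]
  intro g hg
  rw [← inv_eq_one]
  refine Subtype.ext ?_
  have h (r : Fin 2 → F) : r ᵥ* (g⁻¹ : SpecialLinearGroup (Fin 2) F).1 = r := by
    rw [← rowAction_apply, hg]
    rfl
  ext i j
  have := congrFun (h (Pi.single i 1)) j
  rw [single_one_vecMul] at this
  simpa [Matrix.one_apply, Pi.single_apply, eq_comm] using this

variable [CharP K 2] [Finite K]

/-- The block embedding of `SL(2,K)` normalises the elations with centre the second basis vector. -/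
theorem orthogonalHom_mul_elationHom (s : K) (g : SpecialLinearGroup (Fin 2) K) (r : Fin 2 → K) :
    orthogonalHom 0 g * elationHom s (.ofAdd (r ᵥ* g.1)) =
      elationHom s (.ofAdd r) * orthogonalHom 0 g := by
  refine Subtype.ext ?_
  rw [Matrix.SpecialLinearGroup.coe_mul, Matrix.SpecialLinearGroup.coe_mul, orthogonalHom_coe,
    elationHom_coe, elationHom_coe]
  ext i j
  fin_cases i <;> fin_cases j <;>
    simp [orthogonalMatrix, elationMatrix, Matrix.mul_apply, Fin.sum_univ_three, vecMul, dotProduct] <;> ring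

end Affine

/-! ### Minimality of the field generated by the trace -/

section SmallestRoot

theorem isRootOfNat_card_subfield {K : Type*} [Field K] [Finite K] (F : Subfield K) :
    IsRootOfNat (Nat.card F) (Nat.card K) :=
  ⟨Module.finrank F K, Module.finrank_pos, (Module.natCard_eq_pow_finrank (K := F) (V := K)).symm⟩

variable {K : Type*} [Field K] [CharP K 2] [Finite K]

/-- The `x` with `x ^ 2 ^ j = x` form a subfield with at most `2 ^ j` elements. -/
theorem card_closure_singleton_le {d : K} {j : ℕ} (hj : j ≠ 0) (hd : d ^ 2 ^ j = d) :
    Nat.card (Subfield.closure {d}) ≤ 2 ^ j := by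
  classical
  have : Fact (Nat.Prime 2) := ⟨Nat.prime_two⟩
  have hone : 1 < 2 ^ j := Nat.one_lt_two_pow hj
  let p : Polynomial K := Polynomial.X ^ 2 ^ j - Polynomial.X
  have hp : p ≠ 0 := FiniteField.X_pow_card_sub_X_ne_zero K hone
  have hle : Subfield.closure {d} ≤ (iterateFrobenius K 2 j).eqLocusField (RingHom.id K) := by
    rw [Subfield.closure_le, Set.singleton_subset_iff]
    exact hd
  have hsub : (Subfield.closure {d} : Set K) ⊆ (p.roots.toFinset : Set K) := by
    intro x hx
    have : x ^ 2 ^ j = x := hle hx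
    rw [Finset.mem_coe, Multiset.mem_toFinset, Polynomial.mem_roots hp]
    simp [p, this]
  calc Nat.card (Subfield.closure {d}) = (Subfield.closure {d} : Set K).ncard := rfl
    _ ≤ (p.roots.toFinset : Set K).ncard := Set.ncard_le_ncard hsub
    _ = p.roots.toFinset.card := Set.ncard_coe_finset _
    _ ≤ p.roots.card := Multiset.toFinset_card_le _
    _ ≤ p.natDegree := p.card_roots'
    _ = 2 ^ j := FiniteField.X_pow_card_sub_X_natDegree_eq K hone

/-- If a root `2 ^ j` satisfies the divisibility, then `d` is fixed by the `2 ^ j`-power map. So is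
the whole field generated by `d`, which therefore has at most `2 ^ j` elements. -/
theorem isSmallestRootFor_orderOf {d : K} (F : Subfield K) (hF : F = Subfield.closure {d})
    (dF : F) (hdF : (dF : K) = d) (hd : d ≠ 0) :
    IsSmallestRootFor (orderOf (upperUnip 1 * lowerUnip dF : SpecialLinearGroup (Fin 2) F))
      (Nat.card F) (Nat.card K) := by
  have : Fact (Nat.Prime 2) := ⟨Nat.prime_two⟩
  have := Fintype.ofFinite K
  have : CharP F 2 := (RingHom.charP_iff F.subtype F.subtype.injective 2).mpr inferInstance
  have hdF0 : dF ≠ 0 := by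
    rintro rfl
    exact hd (by rw [← hdF]; rfl)
  refine ⟨⟨isRootOfNat_card_subfield F, orderOf_dvd_card_pred_or_succ hdF0⟩, ?_⟩
  rintro r ⟨⟨e, he, hre⟩, hr⟩
  obtain ⟨m, -, hm⟩ := FiniteField.card K 2
  rw [Nat.card_eq_fintype_card, hm] at hre
  obtain ⟨j, -, rfl⟩ := (Nat.dvd_prime_pow Nat.prime_two).mp (hre ▸ dvd_pow_self r he.ne')
  -- The value `r = 1` would meet the divisibility condition for every order, since then `r - 1 =
  -- 0`. It is not a root, because `K` has more than one element.
  have hj : j ≠ 0 := by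
    rintro rfl
    have : 1 < 2 ^ (m : ℕ) := Nat.one_lt_two_pow m.ne_zero
    simp at hre
    omega
  have := pow_eq_self_of_orderOf_dvd hdF0 j hr
  rw [hF]
  refine card_closure_singleton_le hj ?_
  rw [← hdF]
  exact_mod_cast congrArg (Subtype.val) this

end SmallestRoot

/-! ### Model groups realising the two families -/

/-- The groups of the classification over `K`, as a property of an abstract group. -/
def IsListedGroup (K : Type*) [Field K] (Γ : Type*) [Group Γ] : Prop :=
  (∃ k q' : ℕ, 3 ≤ k ∧ IsSmallestRootFor k q' (Nat.card K) ∧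
    ∃ F : Subfield K, Nat.card F = q' ∧ IsFieldSquareByDihedral F k Γ) ∨
  (∃ q' : ℕ, IsRootOfNat q' (Nat.card K) ∧
    ∃ F : Subfield K, Nat.card F = q' ∧ Nonempty (Γ ≃* PSO3 F) ∧
      Nonempty (PSO3 F ≃* Matrix.ProjectiveSpecialLinearGroup (Fin 2) F))

theorem IsListedGroup.of_mulEquiv {K : Type*} [Field K] {Γ Δ : Type*} [Group Γ] [Group Δ]
    (h : IsListedGroup K Γ) (e : Δ ≃* Γ) : IsListedGroup K Δ := by
  rcases h with ⟨k, q', hk, hq, F, hF, φ, hφ, hlin, ⟨e'⟩⟩ | ⟨q', hq, F, hF, ⟨e'⟩, hP⟩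
  · exact .inl ⟨k, q', hk, hq, F, hF, φ, hφ, hlin, ⟨e.trans e'⟩⟩
  · exact .inr ⟨q', hq, F, hF, ⟨e.trans e'⟩, hP⟩

theorem charP_two_subfield {K : Type*} [Field K] [CharP K 2] (F : Subfield K) :
    CharP F 2 :=
  (RingHom.charP_iff F.subtype F.subtype.injective 2).mpr inferInstance

/-- An additive subgroup of a vector space over a finite field that is stable under `d` is stable
under the subfield generated by `d`. -/
theorem closure_singleton_smul_mem {K V : Type*} [Field K] [Finite K] [AddCommGroup V]
    [Module K V] (R : AddSubgroup V) {d : K} (hd : ∀ r ∈ R, d • r ∈ R) {x : K}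
    (hx : x ∈ Subfield.closure {d}) : ∀ r ∈ R, x • r ∈ R := by
  have := Fintype.ofFinite K
  have hpow {y : K} (hy : ∀ r ∈ R, y • r ∈ R) (n : ℕ) : ∀ r ∈ R, y ^ n • r ∈ R := by
    induction n with
    | zero => simp
    | succ n ih =>
      intro r hr
      rw [pow_succ, mul_smul]
      exact ih _ (hy r hr)
  induction hx using Subfield.closure_induction with
  | mem y hy =>
    rw [Set.mem_singleton_iff.mp hy]
    exact hd
  | one => simp
  | add y z _ _ hy hz =>
    intro r hr
    rw [add_smul]
    exact R.add_mem (hy r hr) (hz r hr)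
  | neg y _ hy =>
    intro r hr
    rw [neg_smul]
    exact R.neg_mem (hy r hr)
  | inv y _ hy =>
    by_cases h0 : y = 0
    · simp [h0]
    -- Finiteness turns the inverse into a power, under which stability is already known.
    have : y⁻¹ = y ^ (Fintype.card K - 2) := by
      rw [inv_eq_iff_eq_inv, ← mul_eq_one_iff_eq_inv₀ (pow_ne_zero _ h0), ← pow_succ']
      have hc := Fintype.one_lt_card (α := K)
      rw [show Fintype.card K - 2 + 1 = Fintype.card K - 1 by omega]
      exact FiniteField.pow_card_sub_one_eq_one y h0
    rw [this]
    exact hpow hy _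
  | mul y z _ _ hy hz =>
    intro r hr
    rw [mul_smul]
    exact hy _ (hz r hr)

section

variable {K : Type*} [Field K] [CharP K 2] [Finite K]

theorem isListedGroup_closure_unip {c d : K} (hc0 : c ≠ 0) (hc1 : c ≠ 1) (hd0 : d ≠ 0) :
    IsListedGroup K (Subgroup.closure {upperUnip 1, upperUnip c, lowerUnip d}) := by
  obtain ⟨F, hF⟩ := exists_subfield_closure_eq_range hc0 hc1 hd0
  have := charP_two_subfield F
  have hinj : Function.Injective (SpecialLinearGroup.map (n := Fin 2) F.subtype) := by
    intro x y hxy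
    ext i j
    exact congrArg (fun m : SpecialLinearGroup (Fin 2) K ↦ m i j) hxy
  obtain ⟨e⟩ := nonempty_SL2_mulEquiv_PSO3 (K := F)
  obtain ⟨e'⟩ := nonempty_SL2_mulEquiv_PSL2 (K := F)
  exact .inr ⟨_, isRootOfNat_card_subfield F, F, rfl,
    ⟨(MulEquiv.subgroupCongr hF).trans ((MonoidHom.ofInjective hinj).symm.trans e)⟩,
    ⟨e.symm.trans e'⟩⟩

/-- A subgroup containing block transvections and one elation contains all elations with
entries in the trace field. -/
theorem elationHom_mem_of_mem {d s : K} (hd : d ≠ 0) (C : Subgroup (SpecialLinearGroup (Fin 3) K))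
    (h1 : orthogonalHom 0 (upperUnip 1) ∈ C) (h2 : orthogonalHom 0 (lowerUnip d) ∈ C)
    (h3 : elationHom s (.ofAdd ![0, 1]) ∈ C) {r : Fin 2 → K}
    (hr : ∀ i, r i ∈ Subfield.closure {d}) : elationHom s (.ofAdd r) ∈ C := by
  let R : AddSubgroup (Fin 2 → K) :=
    Subgroup.toAddSubgroup' (C.comap (elationHom s))
  have memR {r : Fin 2 → K} : r ∈ R ↔ elationHom s (.ofAdd r) ∈ C := Iff.rfl
  have hvm {g : SpecialLinearGroup (Fin 2) K} (hg : orthogonalHom 0 g ∈ C) {r : Fin 2 → K}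
      (hr : r ∈ R) : r ᵥ* g.1 ∈ R := by
    rw [memR, eq_inv_mul_of_mul_eq (orthogonalHom_mul_elationHom s g r)]
    exact C.mul_mem (C.inv_mem hg) (C.mul_mem hr hg)
  have hdR : ∀ r ∈ R, d • r ∈ R := by
    intro r hr
    -- For `g = upperUnip 1` and `h = lowerUnip d` the sum `g h + h g` is the scalar `d` in
    -- characteristic two, so stability under both transvections gives stability under `d`.
    have e : d • r = r ᵥ* (upperUnip 1 : SpecialLinearGroup (Fin 2) K).1 ᵥ* (lowerUnip d).1 +
        r ᵥ* (lowerUnip d).1 ᵥ* (upperUnip 1 : SpecialLinearGroup (Fin 2) K).1 := by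
      have h2 := CharTwo.two_eq_zero (R := K)
      ext i
      fin_cases i <;> simp [vecMul, dotProduct, Fin.sum_univ_two, Matrix.mul_apply]
      · linear_combination -(r 0 + r 1 * d) * h2
      · linear_combination -(r 0 + r 1) * h2
    rw [e]
    exact R.add_mem (hvm h2 (hvm h1 hr)) (hvm h1 (hvm h2 hr))
  have key {x : K} (hx : x ∈ Subfield.closure {d}) : ∀ r ∈ R, x • r ∈ R :=
    closure_singleton_smul_mem R hdR hx
  have e1 : (![0, 1] : Fin 2 → K) ∈ R := h3
  -- The image of `![0, 1]` under `lowerUnip d`; the two vectors are independent as `d ≠ 0`.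
  have e0 : (![d, 1] : Fin 2 → K) ∈ R := by
    convert hvm h2 e1 using 1
    ext i
    fin_cases i <;> simp [vecMul, dotProduct, Fin.sum_univ_two]
  have hdF : d ∈ Subfield.closure {d} := Subfield.subset_closure rfl
  have : r = (r 0 / d) • ![d, 1] + (r 1 - r 0 / d) • ![0, 1] := by
    ext i
    fin_cases i <;> simp [hd]
  rw [← memR, this]
  exact R.add_mem (key (Subfield.div_mem _ (hr 0) hdF) _ e0)
    (key (Subfield.sub_mem _ (hr 1) (Subfield.div_mem _ (hr 0) hdF)) _ e1)

/-- The block transvections generate a dihedral complement, already defined over the field `F`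
generated by `d`, and the conjugates of the elation generate all elations with entries in `s • F²`.
A lift from the abstract semidirect product identifies the two groups. -/
theorem isListedGroup_closure_elation {d s : K} (hd : d ≠ 0) (hs : s ≠ 0) :
    IsListedGroup K (Subgroup.closure {orthogonalHom 0 (upperUnip 1),
      elationHom s (.ofAdd ![0, 1]), orthogonalHom 0 (lowerUnip d)}) := by
  set C := Subgroup.closure {orthogonalHom 0 (upperUnip 1),
      elationHom s (.ofAdd ![0, 1]), orthogonalHom 0 (lowerUnip d)} with hC
  have hC1 : orthogonalHom 0 (upperUnip 1) ∈ C := Subgroup.subset_closure (by simp)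
  have hC2 : elationHom s (.ofAdd ![0, 1]) ∈ C := Subgroup.subset_closure (by simp)
  have hC3 : orthogonalHom 0 (lowerUnip d) ∈ C := Subgroup.subset_closure (by simp)
  let F := Subfield.closure {d}
  have hdF : d ∈ F := Subfield.subset_closure rfl
  let dF : F := ⟨d, hdF⟩
  have := charP_two_subfield F
  let a : SpecialLinearGroup (Fin 2) F := upperUnip 1
  let b : SpecialLinearGroup (Fin 2) F := lowerUnip dF
  have ha : a * a = 1 := upperUnip_mul_self 1
  have hb : b * b = 1 := lowerUnip_mul_self dF
  have hab : a * b ≠ b * a := by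
    intro h
    have := congrArg (fun m : SpecialLinearGroup (Fin 2) F ↦ m 0 0) h
    simp [a, b, Matrix.mul_apply, Fin.sum_univ_two, dF] at this
    exact hd (congrArg Subtype.val this)
  obtain ⟨f, hf, hfa, hfb, hfmem⟩ := exists_dihedral_hom ha hb hab
  have hk : 3 ≤ orderOf (a * b) := by
    by_contra hlt
    have h0 : 0 < orderOf (a * b) := orderOf_pos _
    have hdvd : orderOf (a * b) ∣ 2 := by
      have : orderOf (a * b) ≤ 2 := by omega
      generalize orderOf (a * b) = k at *
      interval_cases k <;> decide
    have h1 := orderOf_dvd_iff_pow_eq_one.mp hdvd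
    rw [sq, mul_eq_one_iff_eq_inv, _root_.mul_inv_rev, inv_eq_of_mul_eq_one_left ha,
      inv_eq_of_mul_eq_one_left hb] at h1
    exact hab h1
  let ι : Multiplicative (Fin 2 → F) →* Multiplicative (Fin 2 → K) :=
    AddMonoidHom.toMultiplicative (F.subtype.toAddMonoidHom.compLeft (Fin 2))
  let μ := SpecialLinearGroup.map (n := Fin 2) F.subtype
  have hμinj : Function.Injective μ := by
    intro x y hxy
    ext i j
    exact congrArg (fun m : SpecialLinearGroup (Fin 2) K ↦ m i j) hxy
  have hμa : μ a = upperUnip 1 := by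
    ext i j
    fin_cases i <;> fin_cases j <;> simp [μ, a]
  have hμb : μ b = lowerUnip d := by
    ext i j
    fin_cases i <;> fin_cases j <;> simp [μ, b, dF]
  have hι (r : Fin 2 → F) (g : SpecialLinearGroup (Fin 2) F) :
      ι (.ofAdd (r ᵥ* g.1)) = .ofAdd ((ι (.ofAdd r)).toAdd ᵥ* (μ g).1) := by
    apply Multiplicative.toAdd.injective
    ext i
    exact RingHom.map_vecMul F.subtype g.1 r i
  let φ := (rowAction F).comp f
  let ΘN := (elationHom s).comp ι
  let ΘD := ((orthogonalHom (0 : K)).comp μ).comp f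
  have hcompat : ∀ g, ΘN.comp (φ g).toMonoidHom = (MulAut.conj (ΘD g)).toMonoidHom.comp ΘN := by
    intro g
    refine MonoidHom.ext fun r ↦ ?_
    change ΘN (φ g r) = ΘD g * ΘN r * (ΘD g)⁻¹
    rw [eq_mul_inv_iff_mul_eq]
    have h1 := orthogonalHom_mul_elationHom s (μ (f g)) (ι (φ g r)).toAdd
    refine h1.symm.trans (congrArg (ΘD g * elationHom s ·) ?_)
    have h2 := hι (φ g r).toAdd (f g)
    refine h2.symm.trans ?_
    refine congrArg ι ?_
    change Multiplicative.ofAdd ((r.toAdd ᵥ* ((f g)⁻¹ : SpecialLinearGroup (Fin 2) F).1) ᵥ* (f g).1) = r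
    rw [vecMul_vecMul, ← Matrix.SpecialLinearGroup.coe_mul, inv_mul_cancel]
    simp
  let Θ := SemidirectProduct.lift ΘN ΘD hcompat
  have hΘ (x) : Θ x = ΘN x.left * ΘD x.right := rfl
  -- The four corner entries of the matrix recover the dihedral part, and the middle row then
  -- recovers the translation.
  have hΘinj : Function.Injective Θ := by
    rw [injective_iff_map_eq_one]
    rintro ⟨r, g⟩ hx
    rw [hΘ] at hx
    have hx' : elationMatrix (s • (ι r).toAdd) * orthogonalMatrix 0 (μ (f g)) = 1 :=
      congrArg Subtype.val hx
    have hent (i j : Fin 3) := congrFun (congrFun hx' i) j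
    have h00 := hent 0 0
    have h02 := hent 0 2
    have h20 := hent 2 0
    have h22 := hent 2 2
    simp [elationMatrix, orthogonalMatrix, Matrix.mul_apply, Fin.sum_univ_three] at h00 h02 h20 h22
    have hg : μ (f g) = 1 := by
      ext i j
      fin_cases i <;> fin_cases j <;> simpa
    have hg1 : g = 1 := by
      apply hf
      apply hμinj
      rw [hg, map_one, map_one]
    have h10 := hent 1 0
    have h12 := hent 1 2
    rw [hg] at h10 h12
    simp [elationMatrix, orthogonalMatrix, Matrix.mul_apply, Fin.sum_univ_three, hs] at h10 h12
    have hr : r = 1 := by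
      apply Multiplicative.toAdd.injective
      ext i
      fin_cases i
      · exact h10
      · exact h12
    rw [hg1, hr]
    rfl
  have hrange : Θ.range = C := by
    apply le_antisymm
    · rintro _ ⟨⟨r, g⟩, rfl⟩
      rw [hΘ]
      refine C.mul_mem ?_ ?_
      · exact elationHom_mem_of_mem hd C hC1 hC3 hC2 (r := (ι r).toAdd) (fun i ↦ (r.toAdd i).2)
      · have hle : Subgroup.closure {a, b} ≤ C.comap ((orthogonalHom (0 : K)).comp μ) := by
          rw [Subgroup.closure_le]
          rintro x (rfl | rfl)
          · change orthogonalHom 0 (μ a) ∈ C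
            rwa [hμa]
          · change orthogonalHom 0 (μ b) ∈ C
            rwa [hμb]
        exact hle (hfmem g)
    · rw [hC, Subgroup.closure_le]
      rintro x (rfl | rfl | rfl)
      · refine ⟨SemidirectProduct.inr (.sr 0), ?_⟩
        rw [SemidirectProduct.lift_inr]
        change orthogonalHom 0 (μ (f _)) = _
        rw [hfa, hμa]
      · refine ⟨SemidirectProduct.inl (.ofAdd ![0, 1]), ?_⟩
        rw [SemidirectProduct.lift_inl]
        refine congrArg (elationHom s) ?_
        apply Multiplicative.toAdd.injective
        ext i
        fin_cases i
        · exact F.subtype.map_zero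
        · exact F.subtype.map_one
      · refine ⟨SemidirectProduct.inr (.sr 1), ?_⟩
        rw [SemidirectProduct.lift_inr]
        change orthogonalHom 0 (μ (f _)) = _
        rw [hfb, hμb]
  refine .inl ⟨orderOf (a * b), Nat.card F, hk, isSmallestRootFor_orderOf F rfl dF rfl hd, F, rfl, φ,
    (rowAction_injective F).comp hf, ?_, ?_⟩
  · intro g x v
    change (rowAction F (f g) _).toAdd = x • (rowAction F (f g) _).toAdd
    rw [rowAction_apply, rowAction_apply, smul_vecMul]
  · exact ⟨((MonoidHom.ofInjective hΘinj).trans (MulEquiv.subgroupCongr hrange)).symm⟩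

end

/-! ### Three elations, two of them with a common axis -/

section Elation

variable {K : Type*} [Field K]

/-- The matrix with three given columns. -/
def colMatrix (a b c : Fin 3 → K) : Matrix (Fin 3) (Fin 3) K := of fun i ↦ ![a i, b i, c i]

theorem colMatrix_mulVec (a b c n : Fin 3 → K) :
    colMatrix a b c *ᵥ n = n 0 • a + n 1 • b + n 2 • c := by
  ext i
  simp [colMatrix, mulVec, dotProduct, Fin.sum_univ_three, mul_comm]

theorem vecMul_colMatrix (a b c f : Fin 3 → K) :
    f ᵥ* colMatrix a b c = ![f ⬝ᵥ a, f ⬝ᵥ b, f ⬝ᵥ c] := by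
  ext i
  fin_cases i <;> simp [colMatrix, vecMul, dotProduct, Fin.sum_univ_three]

/-- Serves both to give the frame determinant one and to show that the axes are distinct, `f × g ≠
0`. -/
theorem det_colMatrix_cross (a c f g : Fin 3 → K) :
    (colMatrix a (crossProduct f g) c).det = (f ⬝ᵥ c) * (g ⬝ᵥ a) - (f ⬝ᵥ a) * (g ⬝ᵥ c) := by
  simp [colMatrix, det_fin_three, cross_apply, dotProduct, Fin.sum_univ_three]
  ring

theorem exists_eq_smul_of_cross_eq_zero {w u : Fin 3 → K} (hw : w ≠ 0)
    (h : crossProduct w u = 0) : ∃ b : K, u = b • w := by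
  by_contra! hne
  have : LinearIndependent K ![w, u] :=
    (LinearIndependent.pair_iff' hw).mpr fun a ha ↦ hne a ha.symm
  exact crossProduct_ne_zero_iff_linearIndependent.mpr this h

/-- A vector annihilated by two independent functionals is a multiple of their cross product. -/
theorem exists_eq_smul_cross {f g u : Fin 3 → K} (hw : crossProduct f g ≠ 0)
    (hf : f ⬝ᵥ u = 0) (hg : g ⬝ᵥ u = 0) : ∃ b : K, u = b • crossProduct f g := by
  refine exists_eq_smul_of_cross_eq_zero hw ?_
  rw [cross_cross_eq_smul_sub_smul, hf, hg, zero_smul, zero_smul, sub_zero]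

/-- Conjugating a rank-one perturbation of the identity moves its vector and its functional
separately, so matching generators reduces to two vector identities. -/
theorem conj_eq_of_mulVec {P S T : SpecialLinearGroup (Fin 3) K} {n m v f : Fin 3 → K}
    (hS : S.1 = 1 + vecMulVec n m) (hT : T.1 = 1 + vecMulVec v f)
    (hn : P.1 *ᵥ n = v) (hm : f ᵥ* P.1 = m) : MulAut.conj P S = T := by
  rw [MulAut.conj_apply, mul_inv_eq_iff_eq_mul]
  refine Subtype.ext ?_
  rw [Matrix.SpecialLinearGroup.coe_mul, Matrix.SpecialLinearGroup.coe_mul]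
  change P.1 * S.1 = T.1 * P.1
  rw [hS, hT, mul_add, add_mul, mul_one, one_mul, mul_vecMulVec, vecMulVec_mul, hn, hm]

theorem IsListedGroup.closure_map {Γ : Type*} [Group Γ] {Δ : Type*} [Group Δ] {a b c : Γ}
    {a' b' c' : Δ} (e : Γ →* Δ) (he : Function.Injective e)
    (h : IsListedGroup K (Subgroup.closure {a, b, c}))
    (ha : e a = a') (hb : e b = b') (hc : e c = c') :
    IsListedGroup K (Subgroup.closure {a', b', c'}) := by
  refine h.of_mulEquiv ((Subgroup.equivMapOfInjective _ e he).trans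
    (MulEquiv.subgroupCongr ?_)).symm
  rw [MonoidHom.map_closure, Set.image_insert_eq, Set.image_insert_eq, Set.image_singleton,
    ha, hb, hc]

/-- The frame given by the common kernel of two functionals and vectors dual to them. -/
theorem exists_frame {f g e0 e2 : Fin 3 → K} (h00 : g ⬝ᵥ e0 = 1) (h02 : g ⬝ᵥ e2 = 0)
    (h20 : f ⬝ᵥ e0 = 0) (h22 : f ⬝ᵥ e2 = 1) : ∃ P : SpecialLinearGroup (Fin 3) K,
      (∀ n, P.1 *ᵥ n = n 0 • e0 + n 1 • crossProduct f g + n 2 • e2) ∧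
      g ᵥ* P.1 = ![1, 0, 0] ∧ f ᵥ* P.1 = ![0, 0, 1] := by
  refine ⟨⟨colMatrix e0 (crossProduct f g) e2, ?_⟩, fun n ↦ colMatrix_mulVec _ _ _ _, ?_, ?_⟩
  · rw [det_colMatrix_cross, h00, h02, h20, h22]
    ring
  · exact (vecMul_colMatrix _ _ _ _).trans (by rw [h00, h02, dot_cross_self])
  · exact (vecMul_colMatrix _ _ _ _).trans (by rw [h20, h22, dot_self_cross])

theorem elationHom_coe_eq_add_vecMulVec (s : K) : (elationHom s (.ofAdd ![0, 1])).1 =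
    1 + vecMulVec ![0, s, 0] ![0, 0, 1] := by
  change elationMatrix _ = _
  ext i j
  fin_cases i <;> fin_cases j <;> simp [elationMatrix]

variable [CharP K 2] [Finite K]

theorem orthogonalHom_upperUnip_coe (s t : K) : (orthogonalHom s (upperUnip t)).1 =
    1 + vecMulVec ![t, s * charTwoSqrt K t, 0] ![0, 0, 1] := by
  change orthogonalMatrix s (upperUnip t) = _
  ext i j
  fin_cases i <;> fin_cases j <;> simp [orthogonalMatrix]

theorem orthogonalHom_lowerUnip_coe (s t : K) : (orthogonalHom s (lowerUnip t)).1 =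
    1 + vecMulVec ![0, s * charTwoSqrt K t, t] ![1, 0, 0] := by
  change orthogonalMatrix s (lowerUnip t) = _
  ext i j
  fin_cases i <;> fin_cases j <;> simp [orthogonalMatrix]

variable {f g v₁ v₂ v₃ : Fin 3 → K} {T₁ T₂ T₃ : SpecialLinearGroup (Fin 3) K}

/-- Two elations with a common axis, the second centred on the axis of a third one. -/
theorem isListedGroup_of_center_mem_axis (hT₁ : T₁.1 = 1 + vecMulVec v₁ f)
    (hT₂ : T₂.1 = 1 + vecMulVec v₂ g) (hT₃ : T₃.1 = 1 + vecMulVec v₃ f)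
    (h11 : f ⬝ᵥ v₁ = 0) (h13 : f ⬝ᵥ v₃ = 0) (h22 : g ⬝ᵥ v₂ = 0) (h21 : g ⬝ᵥ v₁ = 1)
    (h12 : f ⬝ᵥ v₂ ≠ 0) (h23 : g ⬝ᵥ v₃ = 0) (h3 : v₃ ≠ 0) :
    IsListedGroup K (Subgroup.closure {T₁, T₃, T₂}) := by
  -- The outer basis vectors are the centres of `T₁` and `T₂`, the latter rescaled, and the middle
  -- one is the meet of the axes. It is also the centre of `T₃`, since `v₃` is killed by `f` and
  -- `g`.
  obtain ⟨P, hP, hgP, hfP⟩ := exists_frame (f := f) (g := g) (e0 := v₁)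
    (e2 := (f ⬝ᵥ v₂)⁻¹ • v₂) h21 (by simp [h22]) h11 (by simp [h12])
  have hw : crossProduct f g ≠ 0 := by
    intro hw
    have := det_colMatrix_cross v₁ v₂ f g
    rw [h11, h21, hw] at this
    simp [colMatrix, det_fin_three] at this
    exact h12 this.symm
  obtain ⟨b, hb⟩ := exists_eq_smul_cross hw h13 h23
  have hb0 : b ≠ 0 := by
    rintro rfl
    exact h3 (by simpa using hb)
  refine (isListedGroup_closure_elation h12 hb0).closure_map (MulAut.conj P).toMonoidHom
    (MulAut.conj P).injective ?_ ?_ ?_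
  · exact conj_eq_of_mulVec (orthogonalHom_upperUnip_coe 0 1) hT₁ (by simp [hP]) hfP
  · exact conj_eq_of_mulVec (elationHom_coe_eq_add_vecMulVec b) hT₃ (by simp [hP, hb]) hfP
  · exact conj_eq_of_mulVec (orthogonalHom_lowerUnip_coe 0 _) hT₂ (by simp [hP, h12]) hgP

/-- Modulo `w = f × g` the generators are the transvections with entries `1`, `c`, `d`. Only the
components along `w` must be matched. Those of `v₁` and `v₂` are absorbed by shifting the basis
vectors along `w`, and that of `v₃` by the choice of `s`. -/
theorem isListedGroup_of_ne_zero_one (hT₁ : T₁.1 = 1 + vecMulVec v₁ f)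
    (hT₂ : T₂.1 = 1 + vecMulVec v₂ g) (hT₃ : T₃.1 = 1 + vecMulVec v₃ f)
    (h11 : f ⬝ᵥ v₁ = 0) (h13 : f ⬝ᵥ v₃ = 0) (h22 : g ⬝ᵥ v₂ = 0) (h21 : g ⬝ᵥ v₁ = 1)
    (h12 : f ⬝ᵥ v₂ ≠ 0) (h23 : g ⬝ᵥ v₃ ≠ 0) (h23' : g ⬝ᵥ v₃ ≠ 1) :
    IsListedGroup K (Subgroup.closure {T₁, T₃, T₂}) := by
  set c := g ⬝ᵥ v₃ with hc
  set d := f ⬝ᵥ v₂ with hd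
  have hw : crossProduct f g ≠ 0 := by
    intro hw
    have := det_colMatrix_cross v₁ v₂ f g
    rw [h11, h21, hw] at this
    simp [colMatrix, det_fin_three] at this
    exact h12 this.symm
  obtain ⟨b, hb⟩ := exists_eq_smul_cross (u := v₃ - c • v₁) hw (by simp [h13, h11])
    (by simp [h21, ← hc])
  have hs : charTwoSqrt K c - c ≠ 0 := by
    intro h
    have h' := charTwoSqrt_sq c
    rw [sub_eq_zero.mp h] at h'
    have : c * (c - 1) = 0 := by linear_combination h'
    rcases mul_eq_zero.mp this with h | h
    · exact h23 h
    · exact h23' (sub_eq_zero.mp h)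
  -- In the model the vectors of `T₁` and `T₃` have middle entries `s` and `s√c`, so `v₃ - c • v₁ =
  -- b • w` requires `s (√c - c) = b`. The bracket vanishes only for `c = 0` or `c = 1`. The value
  -- `s = 0` is allowed.
  let s := b / (charTwoSqrt K c - c)
  have hsb : s * (charTwoSqrt K c - c) = b := div_mul_cancel₀ _ hs
  obtain ⟨P, hP, hgP, hfP⟩ := exists_frame (f := f) (g := g)
    (e0 := v₁ - s • crossProduct f g)
    (e2 := d⁻¹ • (v₂ - (s * charTwoSqrt K d) • crossProduct f g))
    (by simp [h21, dot_cross_self]) (by simp [h22, dot_cross_self])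
    (by simp [h11, dot_self_cross]) (by simp [dot_self_cross, ← hd, h12])
  refine ((isListedGroup_closure_unip h23 h23' h12).closure_map (orthogonalHom s)
    (orthogonalHom_injective s) rfl rfl rfl).closure_map (MulAut.conj P).toMonoidHom
    (MulAut.conj P).injective ?_ ?_ ?_
  · exact conj_eq_of_mulVec (orthogonalHom_upperUnip_coe s 1) hT₁ (by simp [hP]) hfP
  · refine conj_eq_of_mulVec (orthogonalHom_upperUnip_coe s c) hT₃ ?_ hfP
    rw [hP, sub_eq_iff_eq_add.mp hb, ← hsb]
    simp only [cons_val_zero, cons_val_one, cons_val, zero_smul, add_zero]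
    module
  · refine conj_eq_of_mulVec (orthogonalHom_lowerUnip_coe s d) hT₂ ?_ hgP
    rw [hP]
    simp [smul_smul, h12]

theorem Subgroup.closure_triple_mul {Γ : Type*} [Group Γ] (a b c : Γ) :
    Subgroup.closure {a, a * b, c} = Subgroup.closure {a, b, c} := by
  apply le_antisymm
  · rw [Subgroup.closure_le]
    rintro x (rfl | rfl | rfl)
    · exact Subgroup.subset_closure (by simp)
    · exact Subgroup.mul_mem _ (Subgroup.subset_closure (by simp))
        (Subgroup.subset_closure (by simp))
    · exact Subgroup.subset_closure (by simp)
  · rw [Subgroup.closure_le]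
    rintro x (rfl | rfl | rfl)
    · exact Subgroup.subset_closure (by simp)
    · have h : a⁻¹ * (a * x) ∈ Subgroup.closure {a, a * x, c} :=
        Subgroup.mul_mem _ (Subgroup.inv_mem _ (Subgroup.subset_closure (by simp)))
          (Subgroup.subset_closure (by simp))
      rwa [inv_mul_cancel_left] at h
    · exact Subgroup.subset_closure (by simp)

/-- When `c = 1`, the product `T₁ * T₃` is an elation with the same axis and centre `v₁ + v₃`, which
lies on the axis of `T₂`. -/
theorem isListedGroup_of_apply_eq_one (hT₁ : T₁.1 = 1 + vecMulVec v₁ f)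
    (hT₂ : T₂.1 = 1 + vecMulVec v₂ g) (hT₃ : T₃.1 = 1 + vecMulVec v₃ f)
    (h11 : f ⬝ᵥ v₁ = 0) (h13 : f ⬝ᵥ v₃ = 0) (h22 : g ⬝ᵥ v₂ = 0) (h21 : g ⬝ᵥ v₁ = 1)
    (h12 : f ⬝ᵥ v₂ ≠ 0) (h3 : v₃ ≠ 0) (h31 : v₁ ≠ v₃) :
    IsListedGroup K (Subgroup.closure {T₁, T₃, T₂}) := by
  by_cases hc0 : g ⬝ᵥ v₃ = 0
  · exact isListedGroup_of_center_mem_axis hT₁ hT₂ hT₃ h11 h13 h22 h21 h12 hc0 h3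
  by_cases hc1 : g ⬝ᵥ v₃ = 1
  · rw [← Subgroup.closure_triple_mul]
    refine isListedGroup_of_center_mem_axis (v₃ := v₁ + v₃) hT₁ hT₂ ?_ h11 (by simp [h11, h13])
      h22 h21 h12 ?_ ?_
    · rw [Matrix.SpecialLinearGroup.coe_mul]
      change T₁.1 * T₃.1 = _
      rw [hT₁, hT₃, mul_add, add_mul, add_mul, vecMulVec_mul_vecMulVec, h13, add_vecMulVec]
      simp [add_assoc]
    · rw [dotProduct_add, h21, hc1, CharTwo.add_self_eq_zero]
    · intro h
      apply h31
      rw [eq_neg_of_add_eq_zero_left h]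
      ext i
      exact CharTwo.neg_eq (v₃ i)
  · exact isListedGroup_of_ne_zero_one hT₁ hT₂ hT₃ h11 h13 h22 h21 h12 hc0 hc1

theorem isListedGroup_of_apply_ne_zero (hT₁ : T₁.1 = 1 + vecMulVec v₁ f)
    (hT₂ : T₂.1 = 1 + vecMulVec v₂ g) (hT₃ : T₃.1 = 1 + vecMulVec v₃ f)
    (h11 : f ⬝ᵥ v₁ = 0) (h13 : f ⬝ᵥ v₃ = 0) (h22 : g ⬝ᵥ v₂ = 0) (h21 : g ⬝ᵥ v₁ ≠ 0)
    (h12 : f ⬝ᵥ v₂ ≠ 0) (h3 : T₃ ≠ 1) (h31 : T₁ ≠ T₃) :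
    IsListedGroup K (Subgroup.closure {T₁, T₃, T₂}) := by
  refine isListedGroup_of_apply_eq_one (g := (g ⬝ᵥ v₁)⁻¹ • g) (v₂ := (g ⬝ᵥ v₁) • v₂) hT₁ ?_ hT₃
    h11 h13 (by simp [h22]) (by simp [h21]) (by simp [h12, h21]) ?_ ?_
  · rw [hT₂, smul_vecMulVec, vecMulVec_smul, smul_smul, mul_inv_cancel₀ h21, one_smul]
  · rintro rfl
    exact h3 (Subtype.ext (by rw [hT₃, zero_vecMulVec, add_zero]; rfl))
  · rintro rfl
    exact h31 (Subtype.ext (by rw [hT₁, hT₃]))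

/-- Three elations of which the first and third have a common axis generate one of the listed
groups, provided that the axes and centres are in general position. -/
theorem isListedGroup_of_common_axis (hT₁ : T₁.1 = 1 + vecMulVec v₁ f)
    (hT₂ : T₂.1 = 1 + vecMulVec v₂ g) (hT₃ : T₃.1 = 1 + vecMulVec v₃ f)
    (h11 : f ⬝ᵥ v₁ = 0) (h13 : f ⬝ᵥ v₃ = 0) (h22 : g ⬝ᵥ v₂ = 0)
    (h2 : g ⬝ᵥ v₁ ≠ 0 ∨ g ⬝ᵥ v₃ ≠ 0) (h12 : f ⬝ᵥ v₂ ≠ 0) (h1 : T₁ ≠ 1) (h3 : T₃ ≠ 1)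
    (h31 : T₁ ≠ T₃) :
    IsListedGroup K (Subgroup.closure {T₁, T₃, T₂}) ∧
      ∀ A ∈ Subgroup.closure {T₁, T₃, T₂},
        A ∈ Subgroup.center (SpecialLinearGroup (Fin 3) K) → A = 1 := by
  constructor
  · rcases h2 with h2 | h2
    · exact isListedGroup_of_apply_ne_zero hT₁ hT₂ hT₃ h11 h13 h22 h2 h12 h3 h31
    · rw [Set.insert_comm]
      exact isListedGroup_of_apply_ne_zero hT₃ hT₂ hT₁ h13 h11 h22 h2 h12 h1 h31.symm
  · have hw : crossProduct f g ≠ 0 := by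
      intro hw
      have key (v : Fin 3 → K) (hv : f ⬝ᵥ v = 0) : g ⬝ᵥ v = 0 := by
        have := det_colMatrix_cross v v₂ f g
        rw [hv, hw] at this
        simpa [colMatrix, det_fin_three, h12] using this
      exact h2.elim (· (key v₁ h11)) (· (key v₃ h13))
    -- The nonzero vector `f × g` lies on every axis, so the group fixes it, and a scalar that fixes
    -- it is one.
    have hfix : ∀ A ∈ Subgroup.closure {T₁, T₃, T₂},
        A.1 *ᵥ crossProduct f g = crossProduct f g := by
      intro A hA
      induction hA using Subgroup.closure_induction with
      | mem x hx =>
        rcases hx with rfl | rfl | rfl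
        · rw [hT₁, add_mulVec, vecMulVec_mulVec, dot_self_cross]; simp
        · rw [hT₃, add_mulVec, vecMulVec_mulVec, dot_self_cross]; simp
        · rw [hT₂, add_mulVec, vecMulVec_mulVec, dot_cross_self]; simp
      | one => exact one_mulVec _
      | mul x y _ _ hx hy =>
        change (x.1 * y.1) *ᵥ _ = _
        rw [← mulVec_mulVec, hy, hx]
      | inv x _ hx =>
        nth_rw 1 [← hx]
        rw [mulVec_mulVec]
        change (x⁻¹ * x).1 *ᵥ _ = _
        rw [inv_mul_cancel]
        exact one_mulVec _
    intro A hA hc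
    obtain ⟨r, -, hr⟩ := Matrix.SpecialLinearGroup.mem_center_iff.mp hc
    have h := hfix A hA
    rw [← hr, scalar_apply, ← smul_one_eq_diagonal, smul_mulVec, one_mulVec] at h
    have hr1 : r = 1 := by
      by_contra hne
      have : (r - 1) • crossProduct f g = 0 := by rw [sub_smul, h, one_smul, sub_self]
      exact (smul_eq_zero.mp this).elim (fun h ↦ hne (sub_eq_zero.mp h)) hw
    refine Subtype.ext ?_
    rw [← hr, hr1, map_one]
    rfl

end Elation

/-! ### Involutions as elations, commuting pairs, and duality -/

section Elation

variable {K : Type*} [Field K]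

/-- The inverse transpose. -/
def invTranspose (K : Type*) [Field K] :
    SpecialLinearGroup (Fin 3) K →* SpecialLinearGroup (Fin 3) K where
  toFun A := A⁻¹.transpose
  map_one' := by
    rw [inv_one]
    exact Subtype.ext transpose_one
  map_mul' A B := by
    rw [_root_.mul_inv_rev]
    exact Subtype.ext (transpose_mul _ _)

theorem invTranspose_invTranspose (A : SpecialLinearGroup (Fin 3) K) :
    invTranspose K (invTranspose K A) = A := by
  have h : invTranspose K A * A.transpose = 1 :=
    Subtype.ext ((transpose_mul _ _).symm.trans
      ((congrArg (fun B : SpecialLinearGroup (Fin 3) K ↦ B.1ᵀ) (mul_inv_cancel A)).trans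
        transpose_one))
  have h' : (invTranspose K A)⁻¹ = A.transpose := inv_eq_of_mul_eq_one_right h
  change (invTranspose K A)⁻¹.transpose = A
  rw [h']
  exact Subtype.ext (transpose_transpose _)

theorem invTranspose_bijective : Function.Bijective (invTranspose K) :=
  Function.Involutive.bijective invTranspose_invTranspose

theorem center_pow_three {z : SpecialLinearGroup (Fin 3) K}
    (hz : z ∈ Subgroup.center (SpecialLinearGroup (Fin 3) K)) : z ^ 3 = 1 := by
  obtain ⟨r, hr, hrz⟩ := Matrix.SpecialLinearGroup.mem_center_iff.mp hz
  refine Subtype.ext ?_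
  rw [Matrix.SpecialLinearGroup.coe_pow, ← hrz, ← map_pow]
  rw [Fintype.card_fin] at hr
  rw [hr, map_one]
  rfl

/-- An involution of `PSL(3,K)` lifts to an involution of `SL(3,K)`. -/
theorem exists_involution_lift (x : ProjectiveSpecialLinearGroup (Fin 3) K) (hx : orderOf x = 2) :
    ∃ T : SpecialLinearGroup (Fin 3) K, (QuotientGroup.mk T : ProjectiveSpecialLinearGroup _ K) = x ∧
      T * T = 1 ∧ T ≠ 1 := by
  obtain ⟨A, rfl⟩ := QuotientGroup.mk_surjective x
  have hsq : (QuotientGroup.mk (A * A) : ProjectiveSpecialLinearGroup (Fin 3) K) = 1 := by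
    have := pow_orderOf_eq_one (QuotientGroup.mk A : ProjectiveSpecialLinearGroup (Fin 3) K)
    rw [hx, sq] at this
    exact this
  have hz := (QuotientGroup.eq_one_iff _).mp hsq
  have hz3 := center_pow_three hz
  -- Since `A²` is central of exponent three, `A³` has the same image as `A` and squares to one.
  have hmk : (QuotientGroup.mk (A * (A * A)) : ProjectiveSpecialLinearGroup (Fin 3) K) =
      QuotientGroup.mk A := by
    refine (QuotientGroup.mk_mul _ A (A * A)).trans ?_
    rw [hsq, mul_one]
  refine ⟨A * (A * A), hmk, ?_, ?_⟩
  · rw [← hz3]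
    simp only [pow_succ, pow_zero, one_mul, mul_assoc]
  · intro h
    rw [h] at hmk
    have : orderOf (QuotientGroup.mk A : ProjectiveSpecialLinearGroup (Fin 3) K) = 1 := by
      rw [← hmk]
      exact orderOf_one
    omega

/-- The lifts commute up to a central `z`, which satisfies `z³ = 1`. Squaring `S = (T S T) z` gives
`z² = 1` as well, so `z = 1`. -/
theorem mul_comm_of_commute_mk {S T : SpecialLinearGroup (Fin 3) K} (hS : S * S = 1)
    (hT : T * T = 1) (h : Commute (QuotientGroup.mk S : ProjectiveSpecialLinearGroup (Fin 3) K)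
      (QuotientGroup.mk T)) : S * T = T * S := by
  have hz : (T * S)⁻¹ * (S * T) ∈ Subgroup.center (SpecialLinearGroup (Fin 3) K) :=
    QuotientGroup.eq.mp h.symm.eq
  set z := (T * S)⁻¹ * (S * T) with hzdef
  have h1 : S * T = T * S * z := by rw [hzdef, mul_inv_cancel_left]
  have h3 := center_pow_three hz
  rw [Subgroup.mem_center_iff] at hz
  have h2 : z ^ 2 = 1 := by
    have e : S = T * S * T * z := by
      calc S = S * T * T := by rw [mul_assoc, hT, mul_one]
        _ = T * S * (z * T) := by rw [h1, mul_assoc]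
        _ = T * S * T * z := by rw [← hz T, mul_assoc (T * S)]
    have e2 : S * S = T * S * T * (T * S * T) * (z * z) := by
      calc S * S = T * S * T * z * (T * S * T * z) := congrArg₂ (· * ·) e e
        _ = T * S * T * (z * (T * S * T)) * z := by group
        _ = _ := by rw [← hz (T * S * T)]; group
    have e3 : T * S * T * (T * S * T) = 1 := by
      calc T * S * T * (T * S * T) = T * S * (T * T) * S * T := by group
        _ = T * (S * S) * T := by rw [hT]; group
        _ = 1 := by rw [hS, mul_one, hT]
    rw [hS, e3, one_mul] at e2
    rw [sq, ← e2]
  have hz1 : z = 1 := by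
    calc z = z ^ 3 * (z ^ 2)⁻¹ := by group
      _ = 1 := by rw [h3, h2]; simp
  rw [h1, hz1, mul_one]

theorem exists_dotProduct_eq_zero (f g : Fin 3 → K) :
    ∃ w : Fin 3 → K, w ≠ 0 ∧ f ⬝ᵥ w = 0 ∧ g ⬝ᵥ w = 0 := by
  obtain ⟨w, hw, h⟩ := exists_mulVec_eq_zero_iff.mpr
    (det_eq_zero_of_row_eq_zero (A := of ![f, g, 0]) 2 (fun _ ↦ rfl))
  exact ⟨w, hw, congrFun h 0, congrFun h 1⟩

/-- A square-zero matrix in dimension three has rank at most one. -/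
theorem exists_vecMulVec_of_mul_self_eq_zero {N : Matrix (Fin 3) (Fin 3) K} (h : N * N = 0) :
    ∃ v f : Fin 3 → K, N = vecMulVec v f ∧ f ⬝ᵥ v = 0 := by
  -- The image of `N` lies in its kernel, so twice the rank is at most three.
  have hr : Module.finrank K (LinearMap.range N.mulVecLin) ≤ 1 := by
    have := rank_add_rank_le_card_of_mul_eq_zero h
    rw [Fintype.card_fin] at this
    change N.rank ≤ 1
    omega
  obtain ⟨⟨v, hv⟩, hvr⟩ := finrank_le_one_iff.mp hr
  choose f hf using fun j ↦ hvr ⟨N *ᵥ Pi.single j 1, ⟨Pi.single j 1, rfl⟩⟩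
  have hN : N = vecMulVec v f := by
    ext i j
    have := congrFun (congrArg Subtype.val (hf j)) i
    simp at this
    rw [vecMulVec_apply, ← this, mul_comm]
  by_cases hv0 : v = 0
  · exact ⟨0, 0, by rw [hN, hv0]; simp, by simp⟩
  by_cases hf0 : f = 0
  · exact ⟨0, 0, by rw [hN, hf0]; simp, by simp⟩
  refine ⟨v, f, hN, ?_⟩
  rw [hN, vecMulVec_mul_vecMulVec] at h
  by_contra hne
  rcases vecMulVec_eq_zero.mp h with h | h
  · exact hv0 h
  · exact hf0 ((smul_eq_zero.mp h).resolve_left hne)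

/-- Multiplying the relation by `vecMulVec v f` kills one side and yields `(f ⬝ᵥ w) * (g ⬝ᵥ v) = 0`.
Once one factor vanishes, one of the two products is zero, hence so is the other, which makes the
remaining factor vanish. -/
theorem orthogonal_of_commute {v f w g : Fin 3 → K} (hv : vecMulVec v f ≠ 0)
    (hw : vecMulVec w g ≠ 0) (hf : f ⬝ᵥ v = 0)
    (h : vecMulVec v f * vecMulVec w g = vecMulVec w g * vecMulVec v f) :
    f ⬝ᵥ w = 0 ∧ g ⬝ᵥ v = 0 := by
  simp only [ne_eq, vecMulVec_eq_zero, not_or] at hv hw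
  have h0 : (f ⬝ᵥ w) * (g ⬝ᵥ v) = 0 := by
    have := congrArg (vecMulVec v f * ·) h
    simp only [vecMulVec_mul_vecMulVec, hf, zero_smul, vecMulVec_zero, vecMulVec_smul, mul_smul_comm,
      smul_smul, smul_zero] at this
    have := (smul_eq_zero.mp this.symm).resolve_right (by simp [hv])
    rwa [mul_comm] at this
  rw [vecMulVec_mul_vecMulVec, vecMulVec_mul_vecMulVec] at h
  rcases mul_eq_zero.mp h0 with h1 | h1
  · rw [h1, zero_smul, vecMulVec_zero, eq_comm, vecMulVec_smul] at h
    exact ⟨h1, (smul_eq_zero.mp h).resolve_right (by simp [hv, hw])⟩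
  · rw [h1, zero_smul, vecMulVec_zero, vecMulVec_smul] at h
    exact ⟨(smul_eq_zero.mp h).resolve_right (by simp [hv, hw]), h1⟩

variable [CharP K 2]

theorem mul_self_eq_one_of_eq_add_vecMulVec {T : SpecialLinearGroup (Fin 3) K} {v f : Fin 3 → K}
    (hT : T.1 = 1 + vecMulVec v f) (h : f ⬝ᵥ v = 0) : T * T = 1 := by
  refine Subtype.ext ?_
  change T.1 * T.1 = 1
  rw [hT, mul_add, add_mul, add_mul, vecMulVec_mul_vecMulVec, h]
  ext i j
  simp [add_assoc, CharTwo.add_self_eq_zero]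

/-- Duality: centre and axis are exchanged. -/
theorem invTranspose_coe {T : SpecialLinearGroup (Fin 3) K} {v f : Fin 3 → K}
    (hT : T.1 = 1 + vecMulVec v f) (h : f ⬝ᵥ v = 0) :
    (invTranspose K T).1 = 1 + vecMulVec f v := by
  change (T⁻¹).1ᵀ = _
  rw [inv_eq_of_mul_eq_one_left (mul_self_eq_one_of_eq_add_vecMulVec hT h), hT, transpose_add,
    transpose_one, transpose_vecMulVec]

/-- In characteristic two `T² = 1` means `(T - 1)² = 0`. -/
theorem exists_eq_add_vecMulVec {T : SpecialLinearGroup (Fin 3) K} (hT : T * T = 1) :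
    ∃ v f : Fin 3 → K, T.1 = 1 + vecMulVec v f ∧ f ⬝ᵥ v = 0 := by
  have h : T.1 * T.1 = 1 := congrArg Subtype.val hT
  obtain ⟨v, f, hN, hf⟩ := exists_vecMulVec_of_mul_self_eq_zero (N := T.1 - 1) (by
    rw [mul_sub, sub_mul, h]
    ext i j
    have h2 := CharTwo.two_eq_zero (R := K)
    simp
    linear_combination ((1 : Matrix (Fin 3) (Fin 3) K) i j - T.1 i j) * h2)
  exact ⟨v, f, by rw [← hN]; abel, hf⟩

/-- The dual of `isListedGroup_of_common_axis`. -/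
theorem isListedGroup_of_common_center [Finite K] {v f₁ f₃ w g : Fin 3 → K}
    {T₁ T₂ T₃ : SpecialLinearGroup (Fin 3) K} (hT₁ : T₁.1 = 1 + vecMulVec v f₁)
    (hT₂ : T₂.1 = 1 + vecMulVec w g) (hT₃ : T₃.1 = 1 + vecMulVec v f₃)
    (h11 : f₁ ⬝ᵥ v = 0) (h13 : f₃ ⬝ᵥ v = 0) (h22 : g ⬝ᵥ w = 0)
    (h2 : f₁ ⬝ᵥ w ≠ 0 ∨ f₃ ⬝ᵥ w ≠ 0) (h12 : g ⬝ᵥ v ≠ 0) (h1 : T₁ ≠ 1) (h3 : T₃ ≠ 1)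
    (h31 : T₁ ≠ T₃) :
    IsListedGroup K (Subgroup.closure {T₁, T₃, T₂}) ∧
      ∀ A ∈ Subgroup.closure {T₁, T₃, T₂},
        A ∈ Subgroup.center (SpecialLinearGroup (Fin 3) K) → A = 1 := by
  have hinj := (invTranspose_bijective (K := K)).injective
  obtain ⟨hl, hc⟩ := isListedGroup_of_common_axis (invTranspose_coe hT₁ h11)
    (invTranspose_coe hT₂ h22) (invTranspose_coe hT₃ h13) (by rwa [dotProduct_comm])
    (by rwa [dotProduct_comm]) (by rwa [dotProduct_comm])
    (by rwa [dotProduct_comm w, dotProduct_comm w]) (by rwa [dotProduct_comm])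
    (fun h ↦ h1 (hinj (h.trans (map_one _).symm))) (fun h ↦ h3 (hinj (h.trans (map_one _).symm)))
    (fun h ↦ h31 (hinj h))
  refine ⟨hl.closure_map (invTranspose K) hinj (invTranspose_invTranspose _)
    (invTranspose_invTranspose _) (invTranspose_invTranspose _), fun A hA hAc ↦ ?_⟩
  refine hinj ((hc _ ?_ ?_).trans (map_one _).symm)
  · have hle : Subgroup.closure {T₁, T₃, T₂} ≤ (Subgroup.closure
        {invTranspose K T₁, invTranspose K T₃, invTranspose K T₂}).comap (invTranspose K) := by
      rw [Subgroup.closure_le]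
      rintro x (rfl | rfl | rfl) <;> exact Subgroup.subset_closure (by simp)
    exact hle hA
  · rw [Subgroup.mem_center_iff] at hAc ⊢
    intro B
    obtain ⟨B, rfl⟩ := (invTranspose_bijective (K := K)).surjective B
    rw [← map_mul, hAc, map_mul]

end Elation

/-! ### Fixed points and lines of the projective group -/

section Flag

variable {K : Type*} [Field K]

theorem map_toLin'_eq_of_forall_mem (A : SpecialLinearGroup (Fin 3) K)
    {W : Submodule K (Fin 3 → K)} (h : ∀ w ∈ W, A.1 *ᵥ w ∈ W) : W.map (toLin' A.1) = W := by
  refine Submodule.eq_of_le_of_finrank_eq ?_ ?_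
  · rintro _ ⟨w, hw, rfl⟩
    exact h w hw
  · exact LinearEquiv.finrank_map_eq (SpecialLinearGroup.toLin' A) W

theorem map_toLin'_center {z : SpecialLinearGroup (Fin 3) K}
    (hz : z ∈ Subgroup.center (SpecialLinearGroup (Fin 3) K)) (W : Submodule K (Fin 3 → K)) :
    W.map (toLin' z.1) = W := by
  obtain ⟨r, -, hr⟩ := Matrix.SpecialLinearGroup.mem_center_iff.mp hz
  refine map_toLin'_eq_of_forall_mem z fun w hw ↦ ?_
  rw [← hr, scalar_apply, ← smul_one_eq_diagonal, smul_mulVec, one_mulVec]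
  exact W.smul_mem r hw

theorem map_toLin'_mul (A B : SpecialLinearGroup (Fin 3) K) (W : Submodule K (Fin 3 → K)) :
    W.map (toLin' (A * B).1) = (W.map (toLin' B.1)).map (toLin' A.1) := by
  rw [← Submodule.map_comp, ← toLin'_mul]
  rfl

/-- Stabilisation is demanded of every lift of every element. The choice of lift is harmless, as
scalars preserve all subspaces. -/
theorem stabilisesSubspace_closure {ι : Type*} (T : ι → SpecialLinearGroup (Fin 3) K)
    {W : Submodule K (Fin 3 → K)} (h : ∀ i, ∀ w ∈ W, (T i).1 *ᵥ w ∈ W) :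
    StabilisesSubspace (Subgroup.closure (Set.range fun i ↦
      (QuotientGroup.mk (T i) : ProjectiveSpecialLinearGroup (Fin 3) K))) W := by
  intro A hA
  generalize hy : (QuotientGroup.mk A : ProjectiveSpecialLinearGroup (Fin 3) K) = y at hA
  induction hA using Subgroup.closure_induction generalizing A with
  | mem x hx =>
    obtain ⟨i, rfl⟩ := hx
    have hz := QuotientGroup.eq.mp hy.symm
    rw [← mul_inv_cancel_left (T i) A, map_toLin'_mul, map_toLin'_center hz]
    exact map_toLin'_eq_of_forall_mem (T i) (h i)
  | one => exact map_toLin'_center ((QuotientGroup.eq_one_iff _).mp hy) W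
  | mul x y _ _ hx hy' =>
    obtain ⟨B, hB⟩ := QuotientGroup.mk_surjective x
    rw [← mul_inv_cancel_left B A, map_toLin'_mul, hy', hx B hB]
    refine (QuotientGroup.mk_mul _ B⁻¹ A).trans ?_
    rw [hy, QuotientGroup.mk_inv, hB, inv_mul_cancel_left]
  | inv x _ hx =>
    have := hx A⁻¹ ((QuotientGroup.mk_inv _ A).trans (by rw [hy, inv_inv]))
    nth_rw 1 [← this]
    rw [← map_toLin'_mul, mul_inv_cancel]
    exact map_toLin'_eq_of_forall_mem 1 fun w hw ↦ by
      rw [Matrix.SpecialLinearGroup.coe_one, one_mulVec]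
      exact hw

/-- Matrices fixing a vector and a functional that annihilates it generate a group that stabilises
an incident point and line. -/
theorem stabilisesIncidentPointLine_closure {ι : Type*} (T : ι → SpecialLinearGroup (Fin 3) K)
    {x g : Fin 3 → K} (hx : x ≠ 0) (hg : g ≠ 0) (hgx : g ⬝ᵥ x = 0)
    (hTx : ∀ i, (T i).1 *ᵥ x = x) (hTg : ∀ i, g ᵥ* (T i).1 = g) :
    StabilisesIncidentPointLine (Subgroup.closure (Set.range fun i ↦
      (QuotientGroup.mk (T i) : ProjectiveSpecialLinearGroup (Fin 3) K))) := by
  let l : Module.Dual K (Fin 3 → K) := dotProductBilin K K g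
  have hl (w : Fin 3 → K) : l w = g ⬝ᵥ w := rfl
  have hl0 : l ≠ 0 := by
    intro h
    apply hg
    rw [← dotProduct_eq_zero_iff]
    intro w
    rw [← hl, h]
    rfl
  refine ⟨K ∙ x, LinearMap.ker l, finrank_span_singleton hx, ?_, ?_,
    stabilisesSubspace_closure T ?_, stabilisesSubspace_closure T ?_⟩
  · have := Module.Dual.finrank_ker_add_one_of_ne_zero hl0
    rw [Module.finrank_fin_fun] at this
    omega
  · rw [Submodule.span_singleton_le_iff_mem]
    exact hgx
  · intro i w hw
    obtain ⟨c, rfl⟩ := Submodule.mem_span_singleton.mp hw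
    rw [mulVec_smul, hTx]
    exact hw
  · intro i w hw
    rw [LinearMap.mem_ker, hl] at hw ⊢
    rw [dotProduct_mulVec, hTg, hw]

end Flag

/-! ### Case distinction and conclusion -/

section Main

variable {K : Type*} [Field K]

theorem charP_two_of_even_card [Finite K] (h : Even (Nat.card K)) : CharP K 2 := by
  have := Fintype.ofFinite K
  rw [Nat.card_eq_fintype_card] at h
  exact ringChar.of_eq (FiniteField.even_card_iff_char_two.mpr (Nat.even_iff.mp h))

/-- The intersection property enters the classification only here, for the index sets `{0}` and
`{2}`. -/
theorem IsStringCGroup.apply_zero_ne_apply_two {Γ : Type*} [Group Γ] {ρ : Fin 3 → Γ}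
    (h : IsStringCGroup ρ) : ρ 0 ≠ ρ 2 := by
  intro heq
  have hint := h.intersection {0} {2}
  have h02 : ({0} ∩ {2} : Set (Fin 3)) = ∅ := by
    ext x
    simp
  rw [h02, Set.image_empty, Subgroup.closure_empty, Set.image_singleton, Set.image_singleton,
    ← heq, inf_idem] at hint
  have hmem := Subgroup.mem_closure_singleton_self (ρ 0)
  rw [hint, Subgroup.mem_bot] at hmem
  have := h.involution 0
  rw [hmem, orderOf_one] at this
  omega

theorem range_fin_three {α : Type*} (f : Fin 3 → α) : Set.range f = {f 0, f 2, f 1} := by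
  ext x
  simp only [Set.mem_range, Fin.exists_fin_succ, Set.mem_insert_iff, Set.mem_singleton_iff]
  simp [eq_comm]
  tauto

/-- A subgroup of `SL(3,K)` containing no nontrivial scalars is isomorphic to its image. -/
theorem isListedGroup_closure_mk (T : Fin 3 → SpecialLinearGroup (Fin 3) K)
    (h : IsListedGroup K (Subgroup.closure {T 0, T 2, T 1}))
    (hc : ∀ A ∈ Subgroup.closure {T 0, T 2, T 1},
      A ∈ Subgroup.center (SpecialLinearGroup (Fin 3) K) → A = 1) :
    IsListedGroup K (Subgroup.closure (Set.range fun i ↦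
      (QuotientGroup.mk (T i) : ProjectiveSpecialLinearGroup (Fin 3) K))) := by
  let C := Subgroup.closure {T 0, T 2, T 1}
  let π := QuotientGroup.mk' (Subgroup.center (SpecialLinearGroup (Fin 3) K))
  have hinj : Function.Injective (π.comp C.subtype) := by
    rw [injective_iff_map_eq_one]
    intro A hA
    exact Subtype.ext (hc A A.2 ((QuotientGroup.eq_one_iff _).mp hA))
  have hr : (π.comp C.subtype).range = Subgroup.closure (Set.range fun i ↦
      (QuotientGroup.mk (T i) : ProjectiveSpecialLinearGroup (Fin 3) K)) := by
    rw [MonoidHom.range_comp, Subgroup.range_subtype, MonoidHom.map_closure, ← range_fin_three,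
      ← Set.range_comp]
    rfl
  exact h.of_mulEquiv ((MonoidHom.ofInjective hinj).trans (MulEquiv.subgroupCongr hr)).symm

theorem isListedGroup_of_not_stabilisesIncidentPointLine [CharP K 2] [Finite K]
    (T : Fin 3 → SpecialLinearGroup (Fin 3) K) (hT : ∀ i, T i * T i = 1) (hT1 : ∀ i, T i ≠ 1)
    (hcomm : T 0 * T 2 = T 2 * T 0) (hne : T 0 ≠ T 2)
    (hflag : ¬ StabilisesIncidentPointLine (Subgroup.closure (Set.range fun i ↦
      (QuotientGroup.mk (T i) : ProjectiveSpecialLinearGroup (Fin 3) K)))) :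
    IsListedGroup K (Subgroup.closure (Set.range fun i ↦
      (QuotientGroup.mk (T i) : ProjectiveSpecialLinearGroup (Fin 3) K))) := by
  choose v f hvf hfv using fun i ↦ exists_eq_add_vecMulVec (hT i)
  have hN (i) : vecMulVec (v i) (f i) ≠ 0 := fun h ↦
    hT1 i (Subtype.ext (by rw [hvf, h, add_zero]; rfl))
  have hv0 (i) : v i ≠ 0 := fun h ↦ hN i (by rw [h, zero_vecMulVec])
  have hf0 (i) : f i ≠ 0 := fun h ↦ hN i (by rw [h, vecMulVec_zero])
  obtain ⟨h02, h20⟩ := orthogonal_of_commute (hN 0) (hN 2) (hfv 0) (by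
    have := congrArg Subtype.val hcomm
    change (T 0).1 * (T 2).1 = (T 2).1 * (T 0).1 at this
    rw [hvf, hvf] at this
    simp only [mul_add, add_mul, one_mul, mul_one] at this
    have h := congrArg (· - 1 - vecMulVec (v 0) (f 0) - vecMulVec (v 2) (f 2)) this
    convert h using 1 <;> abel)
  have flag {x g : Fin 3 → K} (hx : x ≠ 0) (hg : g ≠ 0) (hgx : g ⬝ᵥ x = 0)
      (hfx : ∀ i, f i ⬝ᵥ x = 0) (hgv : ∀ i, g ⬝ᵥ v i = 0) : False :=
    hflag (stabilisesIncidentPointLine_closure T hx hg hgx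
      (fun i ↦ by rw [hvf, add_mulVec, vecMulVec_mulVec, hfx]; simp)
      (fun i ↦ by rw [hvf, vecMul_add, vecMul_vecMulVec, hgv]; simp))
  have main : IsListedGroup K (Subgroup.closure {T 0, T 2, T 1}) ∧
      ∀ A ∈ Subgroup.closure {T 0, T 2, T 1},
        A ∈ Subgroup.center (SpecialLinearGroup (Fin 3) K) → A = 1 := by
    -- Vanishing means that `T 0` and `T 2` have the same axis.
    by_cases hcr : crossProduct (f 0) (f 2) = 0
    · obtain ⟨b, hb⟩ := exists_eq_smul_of_cross_eq_zero (hf0 0) hcr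
      have hb0 : b ≠ 0 := by
        rintro rfl
        exact hf0 2 (by rw [hb, zero_smul])
      have h3 : (T 2).1 = 1 + vecMulVec (b • v 2) (f 0) := by
        rw [hvf, hb, vecMulVec_smul, smul_vecMulVec]
      -- A point on all three axes, hence fixed. If the centres of `T 0` and `T 2` both lie on the
      -- axis of `T 1`, that axis is a fixed line through `w`; if the centre of `T 1` lies on the
      -- common axis, the common axis is.
      obtain ⟨w, hw, hw0, hw1⟩ := exists_dotProduct_eq_zero (f 0) (f 1)
      have hfw : ∀ i, f i ⬝ᵥ w = 0 := by
        intro i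
        fin_cases i
        · exact hw0
        · exact hw1
        · change f 2 ⬝ᵥ w = 0
          rw [hb, smul_dotProduct, hw0, smul_zero]
      refine isListedGroup_of_common_axis (hvf 0) (hvf 1) h3 (hfv 0) (by simp [h02]) (hfv 1) ?_ ?_
        (hT1 0) (hT1 2) hne
      · by_contra! h
        refine flag hw (hf0 1) hw1 hfw fun i ↦ ?_
        fin_cases i
        · exact h.1
        · exact hfv 1
        · simpa [hb0] using h.2
      · intro h
        refine flag hw (hf0 0) hw0 hfw fun i ↦ ?_
        fin_cases i
        · exact hfv 0
        · exact h
        · exact h02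
    -- With distinct axes, both centres lie on both axes, so each is their meeting point and the
    -- centres coincide.
    · obtain ⟨a, ha⟩ := exists_eq_smul_cross hcr (hfv 0) h20
      obtain ⟨b, hb⟩ := exists_eq_smul_cross hcr h02 (hfv 2)
      set u := crossProduct (f 0) (f 2) with hu
      have ha0 : a ≠ 0 := by
        rintro rfl
        exact hv0 0 (by rw [ha, zero_smul])
      have hb0 : b ≠ 0 := by
        rintro rfl
        exact hv0 2 (by rw [hb, zero_smul])
      have h1 : (T 0).1 = 1 + vecMulVec u (a • f 0) := by
        rw [hvf, ha, vecMulVec_smul, smul_vecMulVec]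
      have h3 : (T 2).1 = 1 + vecMulVec u (b • f 2) := by
        rw [hvf, hb, vecMulVec_smul, smul_vecMulVec]
      have hu0 : f 0 ⬝ᵥ u = 0 := dot_self_cross _ _
      have hu2 : f 2 ⬝ᵥ u = 0 := dot_cross_self _ _
      -- Dually, a line through all three centres is fixed. In the two degenerate positions it
      -- contains a fixed point: the centre of `T 1` or the common centre.
      obtain ⟨g, hg, hgu, hg1⟩ := exists_dotProduct_eq_zero u (v 1)
      rw [dotProduct_comm] at hgu hg1
      have hgv : ∀ i, g ⬝ᵥ v i = 0 := by
        intro i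
        fin_cases i
        · change g ⬝ᵥ v 0 = 0
          rw [ha, dotProduct_smul, hgu, smul_zero]
        · exact hg1
        · change g ⬝ᵥ v 2 = 0
          rw [hb, dotProduct_smul, hgu, smul_zero]
      refine isListedGroup_of_common_center h1 (hvf 1) h3 (by simp [hu0]) (by simp [hu2]) (hfv 1)
        ?_ ?_ (hT1 0) (hT1 2) hne
      · by_contra! h
        refine flag (hv0 1) hg hg1 (fun i ↦ ?_) hgv
        fin_cases i
        · simpa [ha0] using h.1
        · exact hfv 1
        · simpa [hb0] using h.2
      · intro h
        refine flag hcr hg hgu (fun i ↦ ?_) hgv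
        fin_cases i
        · exact hu0
        · exact h
        · exact hu2
  exact isListedGroup_closure_mk T main.1 main.2

end Main

end

theorem theorem5p5 {K : Type*} [Field K] [Finite K] (q : ℕ) (hq : Nat.card K = q)
    (hq_even : Even q)
    (ρ : Fin 3 → Matrix.ProjectiveSpecialLinearGroup (Fin 3) K)
    (hρ : IsStringCGroup ρ)
    (G : Subgroup (Matrix.ProjectiveSpecialLinearGroup (Fin 3) K))
    (hG : G = Subgroup.closure (Set.range ρ))
    (hflag : ¬ StabilisesIncidentPointLine G) :
    (∃ k q' : ℕ, 3 ≤ k ∧ IsSmallestRootFor k q' q ∧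
      ∃ F : Subfield K, Nat.card F = q' ∧ IsFieldSquareByDihedral F k G) ∨
    (∃ q' : ℕ, IsRootOfNat q' q ∧
      ∃ F : Subfield K, Nat.card F = q' ∧ Nonempty (G ≃* PSO3 F) ∧
        Nonempty (PSO3 F ≃* Matrix.ProjectiveSpecialLinearGroup (Fin 2) F)) := by
  subst hq
  have := charP_two_of_even_card hq_even
  choose T hTρ hT hT1 using fun i ↦ exists_involution_lift (ρ i) (hρ.involution i)
  obtain rfl : (fun i ↦ QuotientGroup.mk (T i)) = ρ := funext hTρ
  subst hG
  exact isListedGroup_of_not_stabilisesIncidentPointLine T hT hT1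
    (mul_comm_of_commute_mk (hT 0) (hT 2) (hρ.string 0 2 (by decide)))
    (fun h ↦ hρ.apply_zero_ne_apply_two (congrArg _ h)) hflag
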